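/- Let $d\ge 1$ be an integer, $r>1/2$, and let $\mu$ be the normalized Lebesgue measure on $[0,2\pi]^d$ (opposite faces identified, i.e. on the torus $\mathbb T^d$), so that $\mu$ is a probability measure and $\|f\|_2^2=\int |f|^2\,d\mu$. For $k\in\mathbb Z$ put $k^*:=\max(|k|,1)$, and let $F_r$ be the $2\pi$-periodic integrable function of $d$ variables with Fourier coefficients $$\hat F_r(\mathbf k)=(2\pi)^{-d}\int_{[0,2\pi]^d}F_r(\mathbf x)e^{-i(\mathbf k,\mathbf x)}\,d\mathbf x=\prod_{j=1}^d (k_j^*)^{-r},\qquad \mathbf k\in\mathbb Z^d.$$ Let $\mathbf W^r_2$ be the class of all complex-valued (respectively, all real-valued) functions of the form $$f(\mathbf x)=(2\pi)^{-d}\int_{[0,2\pi]^d}F_r(\mathbf x-\mathbf y)\varphi(\mathbf y)\,d\mathbf y,\qquad \|\varphi\|_2\le 1 .$$ For $m\in\mathbb N$ define the optimal weighted sampling-discretization error $$er_m^o(\mathbf W^r_2,L_2):=\inf_{\xi^1,\dots,\xi^m\in[0,2\pi]^d;\ \lambda_1,\dots,\lambda_m\in\mathbb R}\ \sup_{f\in\mathbf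 W^r_2}\Bigl|\,\|f\|_2^2-\sum_{j=1}^m\lambda_j|f(\xi^j)|^2\Bigr| .$$ Then there are constants $0<c\le C<\infty$, depending only on $r$ and $d$, such that for every integer $m\ge 2$ $$c\,m^{-r}(\log m)^{(d-1)/2}\ \le\ er_m^o(\mathbf W^r_2,L_2)\ \le\ C\,m^{-r}(\log m)^{(d-1)/2}.$$ This holds both for the class of complex-valued and for the class of real-valued functions. -/

import Mathlib

open MeasureTheory
open scoped ENNReal

namespace SamplingDiscretization

noncomputable section

instance factTwoPiPos : Fact ((0 : ℝ) < 2 * Real.pi) := ⟨Real.two_pi_pos⟩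

/-- The `d`-dimensional torus `(ℝ / 2πℤ)^d`, that is, the cube `[0, 2π]^d` with opposite faces
identified. Functions on it are the functions of `d` variables, `2π`-periodic in each variable. -/
abbrev Torus (d : ℕ) : Type := Fin d → AddCircle (2 * Real.pi)

/-- The normalized Lebesgue measure on the torus (a probability measure). -/
def torusMeasure (d : ℕ) : Measure (Torus d) :=
  Measure.pi fun _ => AddCircle.haarAddCircle

instance isProbabilityMeasure_torusMeasure (d : ℕ) : IsProbabilityMeasure (torusMeasure d) := by
  unfold torusMeasure; infer_instance

/-- `torusMeasure d` is the image of the Lebesgue measure on the cube `(0, 2π]^d`, divided by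
`(2π)^d`, under reduction modulo `2π`. -/
theorem map_volume_cube_eq (d : ℕ) :
    ((volume : Measure (Fin d → ℝ)).restrict
        (Set.univ.pi fun _ => Set.Ioc 0 (2 * Real.pi))).map
      (fun x j => (x j : AddCircle (2 * Real.pi))) =
    ENNReal.ofReal (2 * Real.pi) ^ d • torusMeasure d := by
  have h1 : ∀ _ : Fin d, MeasurePreserving ((↑) : ℝ → AddCircle (2 * Real.pi))
      (volume.restrict (Set.Ioc 0 (2 * Real.pi))) volume := fun _ => by
    simpa using AddCircle.measurePreserving_mk (2 * Real.pi) 0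
  have h2 := (measurePreserving_pi _ _ h1).map_eq
  rw [volume_pi, Measure.restrict_pi_pi, h2]
  refine Measure.pi_eq (μ := fun _ : Fin d => (volume : Measure (AddCircle (2 * Real.pi))))
    (fun s _ => ?_)
  simp [torusMeasure, AddCircle.volume_eq_smul_haarAddCircle, Measure.pi_pi,
    Finset.prod_mul_distrib]

/-- The Fourier coefficient `f̂(k) = (2π)^{-d} ∫ f(x) e^{-i(k,x)} dx`. -/
def torusFourierCoeff {d : ℕ} (f : Torus d → ℂ) (k : Fin d → ℤ) : ℂ :=
  ∫ x, (∏ j, fourier (-k j) (x j)) * f x ∂torusMeasure d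

/-- `k^* = max(|k|, 1)`. -/
def starAbs (k : ℤ) : ℝ := max |(k : ℝ)| 1

theorem memℓp_starAbs {r : ℝ} (hr : 1 / 2 < r) :
    Memℓp (fun k : ℤ => ((starAbs k ^ (-r) : ℝ) : ℂ)) 2 := by
  refine memℓp_gen ?_
  have hs : Summable fun k : ℤ => |(k : ℝ)| ^ (-(2 * r)) :=
    Real.summable_abs_int_rpow (by linarith)
  have h0 : Summable fun k : ℤ => |(k : ℝ)| ^ (-(2 * r)) + (if k = 0 then (1 : ℝ) else 0) :=
    hs.add (summable_of_ne_finset_zero (s := {0}) (fun k hk => by simp at hk; simp [hk]))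
  refine Summable.of_nonneg_of_le (fun k => by positivity) (fun k => ?_) h0
  have hpos : 0 < starAbs k := lt_of_lt_of_le one_pos (le_max_right _ _)
  have e : ‖((starAbs k ^ (-r) : ℝ) : ℂ)‖ ^ (2 : ℝ≥0∞).toReal = starAbs k ^ (-(2 * r)) := by
    rw [Complex.norm_real, Real.norm_of_nonneg (by positivity), ← Real.rpow_mul hpos.le]
    congr 1
    simp; ring
  rw [e]
  by_cases hk : k = 0
  · subst hk
    have : (0 : ℝ) ≤ 0 ^ (-(2 * r)) := by positivity
    simpa [starAbs] using this
  · have h1 : (1 : ℝ) ≤ |(k : ℝ)| := by exact_mod_cast Int.one_le_abs hk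
    simp [starAbs, hk, max_eq_left h1]

/-- The univariate kernel: the `L_2` function on the circle with Fourier coefficients
`(k^*)^{-r}`, `k ∈ ℤ`. -/
def univariateKernel {r : ℝ} (hr : 1 / 2 < r) :
    Lp ℂ 2 (@AddCircle.haarAddCircle (2 * Real.pi) _) :=
  fourierBasis.repr.symm ⟨fun k : ℤ => ((starAbs k ^ (-r) : ℝ) : ℂ), memℓp_starAbs hr⟩

/-- The kernel `F_r` on the torus, for `r > 1/2`. It is characterized (almost everywhere, which is
all that matters below) by integrability and its Fourier coefficients `∏_j (k_j^*)^{-r}`; see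
`integrable_mixedKernel` and `torusFourierCoeff_mixedKernel`. -/
def mixedKernel (d : ℕ) {r : ℝ} (hr : 1 / 2 < r) (x : Torus d) : ℂ :=
  ∏ j, univariateKernel hr (x j)

theorem integrable_mixedKernel (d : ℕ) {r : ℝ} (hr : 1 / 2 < r) :
    Integrable (mixedKernel d hr) (torusMeasure d) :=
  Integrable.fintype_prod fun _ => (Lp.memLp (univariateKernel hr)).integrable (by norm_num)

theorem torusFourierCoeff_mixedKernel (d : ℕ) {r : ℝ} (hr : 1 / 2 < r) (k : Fin d → ℤ) :
    torusFourierCoeff (mixedKernel d hr) k = ((∏ j, starAbs (k j) ^ (-r) : ℝ) : ℂ) := by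
  have h1 : ∀ n : ℤ, ∫ t, fourier (-n) t * univariateKernel hr t ∂AddCircle.haarAddCircle
      = ((starAbs n ^ (-r) : ℝ) : ℂ) := fun n => by
    have := fourierBasis_repr (univariateKernel hr) n
    rw [univariateKernel, LinearIsometryEquiv.apply_symm_apply] at this
    simpa [fourierCoeff, univariateKernel] using this.symm
  simp only [torusFourierCoeff, mixedKernel, ← Finset.prod_mul_distrib, torusMeasure]
  rw [integral_fintype_prod_eq_prod
    (f := fun j t => fourier (-k j) t * univariateKernel hr t)]
  simp only [h1, Complex.ofReal_prod]

/-- The mixed-smoothness class `𝐖^r_2`, `r > 1/2`: all functions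
`f(x) = (2π)^{-d} ∫ F_r(x - y) φ(y) dy` with `φ` in `L_2` and `‖φ‖_2 ≤ 1`. -/
def mixedClass (d : ℕ) {r : ℝ} (hr : 1 / 2 < r) : Set (Torus d → ℂ) :=
  {f | ∃ φ : Torus d → ℂ, MemLp φ 2 (torusMeasure d) ∧ eLpNorm φ 2 (torusMeasure d) ≤ 1 ∧
    ∀ x, f x = ∫ y, mixedKernel d hr (x - y) * φ y ∂torusMeasure d}

/-- The real-valued functions in `𝐖^r_2`. -/
def realMixedClass (d : ℕ) {r : ℝ} (hr : 1 / 2 < r) : Set (Torus d → ℂ) :=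
  {f ∈ mixedClass d hr | ∀ x, (f x).im = 0}

/-- The optimal weighted discretization error
`er_m^o(W, L_q) = inf_{ξ, λ} sup_{f ∈ W} | ‖f‖_q^q - ∑_{j=1}^m λ_j |f(ξ^j)|^q |`,
as an element of `[0, ∞]`. The weights are arbitrary real numbers. -/
def optimalError {Ω : Type*} [MeasurableSpace Ω] (μ : Measure Ω) (W : Set (Ω → ℂ)) (q : ℝ)
    (m : ℕ) : ℝ≥0∞ :=
  ⨅ (ξ : Fin m → Ω) (w : Fin m → ℝ), ⨆ f ∈ W,
    ENNReal.ofReal |∫ x, ‖f x‖ ^ q ∂μ - ∑ j, w j * ‖f (ξ j)‖ ^ q|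

end

end SamplingDiscretization

open SamplingDiscretization

open scoped ComplexConjugate

/-! Upper bound. Write f as the sum of c_k e^{i(k,x)}. Expanding |f|² turns the discretization error
into the sum of c_k conj(c_l) E(k-l) over pairs, where E(k) is the error of the point sum, read as a
cubature formula, at the monomial k. With p = 2r and w(k) = ∏ (k_j^*)^{-p}, Cauchy–Schwarz over
pairs bounds its square by ∑ w(k) w(l) |E(k-l)|² (`abs_integral_sub_sum_le`). Since p > 1, the
autocorrelation of w is at most a constant times w, so ∑ w(k) |E(k)|² has to be made small.

The nodes are 2πB⁻ᵀ(z+u) with z integral, weighted by |det B|⁻¹ times a smooth window whose integer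
translates sum to 1. Parseval in the shift u shows that the mean of |E(k)|² is the sum over n ≠ 0 of
the squared Fourier transform of the window at k - Bn (`lintegral_shiftedCubature_error`).
Convolving with w leaves ∑_{n≠0} ∏ (1+|(Bn)_j|)^{-p} (`lintegral_tsum_error_le`). For B = aL, with L
a Vandermonde matrix in the roots of an irreducible integer polynomial (`exists_admissible_forms`),
the coordinates of Bn have product at least V = a^d in absolute value, and a dyadic count gives
order V^{-2r} (1 + log V)^{d-1} (`sum_admissible_le`). Some shift does as well as the mean, and
about V nodes are used; a square root finishes.

Lower bound. For given nodes and each dyadic box of frequencies of volume 2^n ≥ 2m there is a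
polynomial g_s with |g_s| ≤ 1, zero at the nodes, of mean at least 1/2 (`exists_fooling`). Let G be
the sum of g_s over the roughly n^{d-1} boxes s. A frequency lying in many boxes has a small
smoothness weight (`mixedWeight_mul_card_le`), so the smoothness norm of G is only O(2^{nr}) times
the square root of the number of boxes, while its mean is proportional to that number. The functions
1/2 ± τG agree at the nodes, yet their squared norms differ by 2τ∫G; so every choice of weights
fails on one of them (`le_optimalError`). -/

namespace SamplingDiscretization

/-! ### Linear forms with product bounded below at nonzero integer points -/

section AdmissibleForms

open Polynomial

/-- The polynomial `∏ (X - 4i) - 1`. -/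
noncomputable def shiftedProductPoly (d : ℕ) : ℤ[X] := (∏ i : Fin d, (X - C (4 * (i : ℤ)))) - 1

theorem monic_prod_X_sub (d : ℕ) : (∏ i : Fin d, (X - C (4 * (i : ℤ)))).Monic :=
  monic_prod_of_monic _ _ fun _ _ => monic_X_sub_C _

theorem natDegree_prod_X_sub (d : ℕ) : (∏ i : Fin d, (X - C (4 * (i : ℤ)))).natDegree = d := by
  rw [natDegree_prod_of_monic _ _ fun _ _ => monic_X_sub_C _]
  simp only [natDegree_X_sub_C]
  simp

theorem degree_one_lt {d : ℕ} (hd : 1 ≤ d) :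
    (1 : ℤ[X]).degree < (∏ i : Fin d, (X - C (4 * (i : ℤ)))).degree := by
  rw [degree_eq_natDegree (monic_prod_X_sub d).ne_zero, natDegree_prod_X_sub, degree_one]
  exact_mod_cast hd

theorem monic_shiftedProductPoly {d : ℕ} (hd : 1 ≤ d) : (shiftedProductPoly d).Monic :=
  (monic_prod_X_sub d).sub_of_left (degree_one_lt hd)

theorem natDegree_shiftedProductPoly {d : ℕ} (hd : 1 ≤ d) :
    (shiftedProductPoly d).natDegree = d := by
  have h : (shiftedProductPoly d).degree = d := by
    rw [shiftedProductPoly, degree_sub_eq_left_of_degree_lt (degree_one_lt hd),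
      degree_eq_natDegree (monic_prod_X_sub d).ne_zero, natDegree_prod_X_sub]
  exact natDegree_eq_of_degree_eq_some h

theorem eval_shiftedProductPoly (d : ℕ) (i : Fin d) :
    (shiftedProductPoly d).eval (4 * (i : ℤ)) = -1 := by
  simp only [shiftedProductPoly, eval_sub, eval_prod, eval_X, eval_C, eval_one]
  rw [Finset.prod_eq_zero (Finset.mem_univ i) (by simp)]
  simp

/-- Schur's argument: in a monic factorization fg the factors take opposite values ±1 at the d
points 4i, so f + g has d zeros but degree below d. Then f = -g, which is impossible for two monic
polynomials. -/
theorem irreducible_shiftedProductPoly {d : ℕ} (hd : 1 ≤ d) :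
    Irreducible (shiftedProductPoly d) := by
  rw [(monic_shiftedProductPoly hd).irreducible_iff_natDegree']
  refine ⟨fun h => ?_, fun f g hf hg hfg hdeg => ?_⟩
  · have := natDegree_shiftedProductPoly hd
    rw [h, natDegree_one] at this
    omega
  rw [natDegree_shiftedProductPoly hd, Finset.mem_Ioc] at hdeg
  have hsum : f.natDegree + g.natDegree = d := by
    rw [← hf.natDegree_mul hg, hfg, natDegree_shiftedProductPoly hd]
  have hroot : ∀ i : Fin d, (f + g).eval (4 * (i : ℤ)) = 0 := fun i => by
    have h1 : f.eval (4 * (i : ℤ)) * g.eval (4 * (i : ℤ)) = -1 := by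
      rw [← eval_mul, hfg, eval_shiftedProductPoly]
    rw [eval_add]
    rcases Int.mul_eq_neg_one_iff_eq_one_or_neg_one.1 h1 with ⟨h, h'⟩ | ⟨h, h'⟩ <;> simp [h, h']
  have hzero : f + g = 0 := by
    refine eq_zero_of_natDegree_lt_card_of_eval_eq_zero (f + g)
      (f := fun i : Fin d => 4 * (i : ℤ)) (fun i j hij => ?_) hroot ?_
    · ext; simpa using hij
    · refine lt_of_le_of_lt (natDegree_add_le _ _) ?_
      simp only [Fintype.card_fin]
      omega
  have h2 : f = -g := eq_neg_of_add_eq_zero_left hzero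
  have h3 := hf.leadingCoeff
  rw [h2, leadingCoeff_neg, hg.leadingCoeff] at h3
  norm_num at h3

/-- At 4j ± 3/2 every factor of the product exceeds 1 in absolute value, so subtracting 1 does not
change its sign. The sign differs at the two points because only the j-th factor changes sign. The
spacing 4 also keeps the d roots apart. -/
theorem exists_root_shiftedProductPoly {d : ℕ} (j : Fin d) :
    ∃ x : ℝ, |x - 4 * (j : ℝ)| ≤ 3 / 2 ∧ aeval x (shiftedProductPoly d) = 0 := by
  have hev : ∀ x : ℝ, aeval x (shiftedProductPoly d) = ∏ i : Fin d, (x - 4 * (i : ℝ)) - 1 := by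
    intro x
    simp only [shiftedProductPoly, map_sub, map_prod, aeval_X, aeval_C, map_one]
    simp
  have hneg : (∏ i : Fin d, ((4 * (j : ℝ) - 3 / 2) - 4 * (i : ℝ))) *
      (∏ i : Fin d, ((4 * (j : ℝ) + 3 / 2) - 4 * (i : ℝ))) < 0 := by
    rw [← Finset.prod_mul_distrib, ← Finset.mul_prod_erase _ _ (Finset.mem_univ j)]
    refine mul_neg_of_neg_of_pos (by nlinarith) (Finset.prod_pos fun i hi => ?_)
    have h1 : (1 : ℝ) ≤ ((j : ℝ) - (i : ℝ)) ^ 2 := by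
      have : ((j : ℕ) : ℤ) - ((i : ℕ) : ℤ) ≠ 0 := by
        intro h
        apply (Finset.mem_erase.1 hi).1
        ext; omega
      have h2 : (1 : ℤ) ≤ (((j : ℕ) : ℤ) - ((i : ℕ) : ℤ)) ^ 2 := by
        exact Int.add_one_le_of_lt (lt_of_le_of_ne (sq_nonneg _) (pow_ne_zero 2 this).symm)
      exact_mod_cast h2
    nlinarith
  have habs : ∀ x : ℝ, (∀ i : Fin d, 1 < |x - 4 * (i : ℝ)|) →
      1 < |∏ i : Fin d, (x - 4 * (i : ℝ))| := fun x hx => by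
    rw [Finset.abs_prod]
    have := Finset.prod_lt_prod_of_nonempty (s := (Finset.univ : Finset (Fin d)))
      (f := fun _ => (1 : ℝ)) (g := fun i : Fin d => |x - 4 * (i : ℝ)|) (fun _ _ => one_pos)
      (fun i _ => hx i) ⟨j, Finset.mem_univ _⟩
    simpa using this
  have hfar : ∀ (i : Fin d) (e : ℝ), |e| = 3 / 2 → 1 < |4 * (j : ℝ) + e - 4 * (i : ℝ)| := by
    intro i e he
    rcases eq_or_ne ((j : ℕ) : ℤ) ((i : ℕ) : ℤ) with h | h
    · have h' : (j : ℝ) = (i : ℝ) := by exact_mod_cast h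
      rw [h', show 4 * (i : ℝ) + e - 4 * (i : ℝ) = e by ring, he]
      norm_num
    · have h1 : (1 : ℤ) ≤ |((j : ℕ) : ℤ) - ((i : ℕ) : ℤ)| := Int.one_le_abs (sub_ne_zero.2 h)
      have h2 : (1 : ℝ) ≤ |(j : ℝ) - (i : ℝ)| := by exact_mod_cast h1
      have h3 : |4 * ((j : ℝ) - (i : ℝ))| ≤ |4 * (j : ℝ) + e - 4 * (i : ℝ)| + |e| := by
        have := abs_sub (4 * (j : ℝ) + e - 4 * (i : ℝ)) e
        rwa [show 4 * (j : ℝ) + e - 4 * (i : ℝ) - e = 4 * ((j : ℝ) - (i : ℝ)) by ring] at this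
      rw [abs_mul, he, abs_of_pos (by norm_num : (0 : ℝ) < 4)] at h3
      linarith
  have hm := habs (4 * (j : ℝ) - 3 / 2) fun i => by
    simpa [sub_eq_add_neg] using hfar i (-(3 / 2)) (by norm_num [abs_of_nonneg])
  have hp := habs (4 * (j : ℝ) + 3 / 2) fun i => hfar i (3 / 2) (by norm_num [abs_of_nonneg])
  have hcont : Continuous fun x : ℝ => aeval x (shiftedProductPoly d) :=
    (shiftedProductPoly d).continuous_aeval
  have hmem : (0 : ℝ) ∈ Set.uIcc (aeval (4 * (j : ℝ) - 3 / 2) (shiftedProductPoly d))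
      (aeval (4 * (j : ℝ) + 3 / 2) (shiftedProductPoly d)) := by
    rw [hev, hev, Set.mem_uIcc]
    rcases lt_abs.1 hm with h | h <;> rcases lt_abs.1 hp with h' | h'
    · nlinarith
    · right; constructor <;> linarith
    · left; constructor <;> linarith
    · nlinarith
  obtain ⟨x, hx, hx0⟩ := intermediate_value_uIcc hcont.continuousOn hmem
  rw [Set.uIcc_of_le (by linarith)] at hx
  exact ⟨x, abs_le.2 ⟨by linarith [hx.1], by linarith [hx.2]⟩, hx0⟩

/-- There are `d` linear forms in `d` variables whose product is at least `1` in absolute value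
at all nonzero integer points. -/
theorem exists_admissible_forms {d : ℕ} (hd : 1 ≤ d) :
    ∃ L : Matrix (Fin d) (Fin d) ℝ, L.det ≠ 0 ∧
      ∀ n : Fin d → ℤ, n ≠ 0 → 1 ≤ |∏ j, (L.mulVec fun i => (n i : ℝ)) j| := by
  choose ζ hζ hroot using fun j : Fin d => exists_root_shiftedProductPoly j
  have hinj : Function.Injective ζ := fun i j hij => by
    by_contra hne
    have h1 : (1 : ℤ) ≤ |((j : ℕ) : ℤ) - ((i : ℕ) : ℤ)| :=
      Int.one_le_abs (sub_ne_zero.2 fun h => hne (by ext; omega))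
    have h2 : (1 : ℝ) ≤ |(j : ℝ) - (i : ℝ)| := by exact_mod_cast h1
    have h3 := hζ i
    have h4 := hζ j
    rw [hij] at h3
    rw [abs_le] at h3 h4
    rcases le_abs.1 h2 with h | h <;> linarith [h3.1, h3.2, h4.1, h4.2]
  -- The forms evaluate the polynomial g with coefficients n at the conjugate roots ζ_j of P. Their
  -- product is the norm of g(ζ), that is, the resultant of P and g: a nonzero integer.
  refine ⟨Matrix.vandermonde ζ, Matrix.det_vandermonde_ne_zero_iff.2 hinj, fun n hn => ?_⟩
  set P := shiftedProductPoly d with hP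
  have hPm : P.Monic := monic_shiftedProductPoly hd
  set g : ℤ[X] := ∑ i : Fin d, C (n i) * X ^ (i : ℕ) with hg
  have hgdeg : g.natDegree ≤ d - 1 := by
    refine natDegree_sum_le_of_forall_le _ _ fun i _ => (natDegree_C_mul_X_pow_le _ _).trans ?_
    have := i.2
    omega
  have hgcoeff : ∀ i : Fin d, g.coeff i = n i := fun i => by
    simp only [hg, finsetSum_coeff, coeff_C_mul, coeff_X_pow]
    rw [Finset.sum_eq_single i]
    · simp
    · intro b _ hb
      have : (i : ℕ) ≠ b := fun h => hb (by ext; omega)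
      simp [this]
    · simp
  have hg0 : g ≠ 0 := fun h => hn (by
    ext i
    rw [← hgcoeff, h]
    simp)
  have hLg : ∀ j, ((Matrix.vandermonde ζ).mulVec fun i => (n i : ℝ)) j = aeval (ζ j) g := by
    intro j
    simp [hg, Matrix.mulVec, dotProduct, Matrix.vandermonde_apply, map_sum, mul_comm]
  -- P is the minimal polynomial of ζ_j up to a unit, and g has smaller degree.
  have hne : ∀ j, aeval (ζ j) g ≠ 0 := fun j h => by
    have hint : IsIntegral ℤ (ζ j) := ⟨P, hPm, by simpa [aeval_def] using hroot j⟩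
    have hdvd := minpoly.isIntegrallyClosed_dvd hint (hroot j)
    obtain ⟨q, hq⟩ := hdvd
    have hunit : IsUnit q := by
      rcases (irreducible_shiftedProductPoly hd).isUnit_or_isUnit hq with h' | h'
      · exact absurd h' (minpoly.not_isUnit ℤ (ζ j))
      · exact h'
    have hqm : q.natDegree = 0 := natDegree_eq_zero_of_isUnit hunit
    have hdeg : (minpoly ℤ (ζ j)).natDegree = d := by
      have hq0 : q ≠ 0 := hunit.ne_zero
      have := natDegree_shiftedProductPoly hd
      rw [← hP, hq, natDegree_mul (minpoly.ne_zero hint) hq0, hqm] at this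
      simpa using this
    have := natDegree_le_of_dvd (minpoly.isIntegrallyClosed_dvd hint h) hg0
    omega
  have hroots : (P.map (Int.castRingHom ℝ)) = ∏ j : Fin d, (X - C (ζ j)) := by
    refine eq_of_monic_of_dvd_of_natDegree_le
      (monic_prod_of_monic _ (fun j => X - C (ζ j)) fun _ _ => monic_X_sub_C _) (hPm.map _) ?_ ?_
    · refine Finset.prod_dvd_of_coprime (fun i _ j _ hij => ?_) fun j _ => ?_
      · exact pairwise_coprime_X_sub_C hinj hij
      · rw [dvd_iff_isRoot, IsRoot, eval_map]
        simpa [aeval_def] using hroot j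
    · rw [hPm.natDegree_map, natDegree_shiftedProductPoly hd,
        natDegree_prod_of_monic _ _ fun _ _ => monic_X_sub_C _]
      simp
  have hres := resultant_eq_prod_eval (P.map (Int.castRingHom ℝ)) (g.map (Int.castRingHom ℝ))
    (d - 1) (natDegree_map_le.trans hgdeg)
    (by rw [hroots]; exact Splits.prod fun j _ => Splits.X_sub_C _)
  rw [resultant_map_map, (hPm.map _).leadingCoeff, one_pow, one_mul] at hres
  have hprod : ((P.map (Int.castRingHom ℝ)).roots.map (eval · (g.map (Int.castRingHom ℝ)))).prod
      = ∏ j, aeval (ζ j) g := by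
    have h := roots_multiset_prod_X_sub_C ((Finset.univ : Finset (Fin d)).val.map ζ)
    rw [Multiset.map_map] at h
    rw [hroots, Finset.prod, ← Function.comp_def (fun a => X - C a) ζ, h, Multiset.map_map]
    simp [aeval_def, eval_map, Finset.prod]
  simp_rw [hLg]
  rw [← hprod]
  have hne' : (∏ j, aeval (ζ j) g) ≠ 0 := Finset.prod_ne_zero_iff.2 fun j _ => hne j
  rw [← hprod] at hne'
  rw [← hres] at hne' ⊢
  simp only [eq_intCast] at hne' ⊢
  have := Int.one_le_abs (Int.cast_ne_zero.1 hne')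
  exact_mod_cast this

end AdmissibleForms

/-! ### Counting points of admissible lattices -/

section LatticeSum

theorem card_piAntidiag_le (e l : ℕ) :
    (Finset.piAntidiag (Finset.univ : Finset (Fin (e + 1))) l).card ≤ (l + 1) ^ e := by
  have h : (Fintype.piFinset fun _ : Fin e => Finset.range (l + 1)).card = (l + 1) ^ e := by
    simp
  rw [← h]
  refine Finset.card_le_card_of_injOn (fun s => Fin.tail s) (fun s hs => ?_) ?_
  · simp only [Finset.mem_coe, Finset.mem_piAntidiag] at hs
    simp only [Finset.mem_coe, Fintype.mem_piFinset, Finset.mem_range]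
    intro i
    have := Finset.single_le_sum (f := s) (fun _ _ => Nat.zero_le _) (Finset.mem_univ i.succ)
    rw [hs.1] at this
    simp only [Fin.tail]
    omega
  · intro s hs t ht hst
    simp only [Finset.mem_coe, Finset.mem_piAntidiag] at hs ht
    have h1 := hs.1
    have h2 := ht.1
    rw [Fin.sum_univ_succ] at h1 h2
    have h3 : ∀ i : Fin e, s i.succ = t i.succ := fun i => congrFun hst i
    simp only [h3] at h1
    funext i
    refine Fin.cases ?_ h3 i
    omega

/-- All coordinates but the first may be chosen freely up to n/(e+1); the first one takes up the
remainder. -/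
theorem le_card_piAntidiag (e n : ℕ) :
    (n / (e + 1) + 1) ^ e ≤ (Finset.piAntidiag (Finset.univ : Finset (Fin (e + 1))) n).card := by
  have h : (Fintype.piFinset fun _ : Fin e => Finset.range (n / (e + 1) + 1)).card
      = (n / (e + 1) + 1) ^ e := by
    simp
  rw [← h]
  refine Finset.card_le_card_of_injOn
    (fun s => (Fin.cons (n - ∑ i, s i) s : Fin (e + 1) → ℕ)) (fun s hs => ?_) ?_
  · simp only [Finset.mem_coe, Fintype.mem_piFinset, Finset.mem_range] at hs
    simp only [Finset.mem_coe, Finset.mem_piAntidiag, Fin.sum_univ_succ, Fin.cons_zero,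
      Fin.cons_succ, Finset.mem_univ, implies_true, and_true]
    have h1 : ∑ i, s i ≤ ∑ _i : Fin e, n / (e + 1) :=
      Finset.sum_le_sum fun i _ => Nat.lt_succ_iff.1 (hs i)
    rw [Finset.sum_const, Finset.card_univ, Fintype.card_fin, smul_eq_mul] at h1
    have h2 := Nat.div_mul_le_self n (e + 1)
    have h3 : e * (n / (e + 1)) ≤ n / (e + 1) * (e + 1) := by
      rw [mul_comm]
      exact Nat.mul_le_mul_left _ (Nat.le_succ e)
    omega
  · intro s _ t _ hst
    exact (Fin.cons_inj.1 hst).2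

/-- A lattice with admissibility constant `V` has at most `∏ (2 T_j) / V + 2` points in the
box with half-sides `T_j`. -/
theorem card_lattice_box_le {e : ℕ} (M : (Fin (e + 1) → ℤ) →+ (Fin (e + 1) → ℝ)) {V : ℝ}
    (hV : 0 < V) (hM : ∀ n, n ≠ 0 → V ≤ ∏ j, |M n j|) {T : Fin (e + 1) → ℝ} (hT : ∀ j, 0 < T j)
    (D : Finset (Fin (e + 1) → ℤ)) (hD : ∀ n ∈ D, ∀ j, |M n j| < T j) :
    (D.card : ℝ) ≤ (∏ j, 2 * T j) / V + 2 := by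
  set R := ∏ j : Fin e, 2 * T j.succ with hR
  have hRpos : 0 < R := Finset.prod_pos fun j _ => mul_pos two_pos (hT _)
  -- Slice the box along the first coordinate into slabs of thickness h. Two lattice points in one
  -- slab would differ by a vector with coordinate product below V, so each slab holds at most one
  -- point.
  set h := V / R with hh
  have hhpos : 0 < h := div_pos hV hRpos
  have hinj : Set.InjOn (fun n => ⌊M n 0 / h⌋) (D : Set (Fin (e + 1) → ℤ)) := by
    intro n hn m hm hnm
    by_contra hne
    have h1 := hM (n - m) (sub_ne_zero.2 hne)
    rw [Fin.prod_univ_succ] at h1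
    have h2 : |M (n - m) 0| < h := by
      have := Int.abs_sub_lt_one_of_floor_eq_floor hnm
      rw [← sub_div, abs_div, abs_of_pos hhpos, div_lt_one hhpos] at this
      simpa using this
    have h3 : ∏ j : Fin e, |M (n - m) j.succ| ≤ R := by
      refine Finset.prod_le_prod (fun _ _ => abs_nonneg _) fun j _ => ?_
      have ha := hD n hn j.succ
      have hb := hD m hm j.succ
      rw [map_sub, Pi.sub_apply]
      have := abs_sub (M n j.succ) (M m j.succ)
      linarith
    have h4 : |M (n - m) 0| * ∏ j : Fin e, |M (n - m) j.succ| < V :=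
      calc _ ≤ |M (n - m) 0| * R := mul_le_mul_of_nonneg_left h3 (abs_nonneg _)
        _ < h * R := mul_lt_mul_of_pos_right h2 hRpos
        _ = V := div_mul_cancel₀ _ hRpos.ne'
    linarith
  have hmaps : ∀ n ∈ D, (fun n => ⌊M n 0 / h⌋) n ∈
      Finset.Icc ⌊-T 0 / h⌋ ⌊T 0 / h⌋ := fun n hn => by
    have := abs_lt.1 (hD n hn 0)
    rw [Finset.mem_Icc]
    constructor
    · exact Int.floor_le_floor (div_le_div_of_nonneg_right this.1.le hhpos.le)
    · exact Int.floor_le_floor (div_le_div_of_nonneg_right this.2.le hhpos.le)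
  have hcard := Finset.card_le_card_of_injOn _ hmaps hinj
  rw [Int.card_Icc] at hcard
  have h1 : (D.card : ℤ) ≤ ⌊T 0 / h⌋ + 1 - ⌊-T 0 / h⌋ := by
    have : ⌊-T 0 / h⌋ ≤ ⌊T 0 / h⌋ := by
      refine Int.floor_le_floor (div_le_div_of_nonneg_right ?_ hhpos.le)
      linarith [hT 0]
    omega
  have h2 : (D.card : ℝ) ≤ ⌊T 0 / h⌋ + 1 - ⌊-T 0 / h⌋ := by exact_mod_cast h1
  have h3 := Int.floor_le (T 0 / h)
  have h4 := Int.lt_floor_add_one (-T 0 / h)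
  have h5 : (∏ j, 2 * T j) / V = 2 * (T 0 / h) := by
    rw [Fin.prod_univ_succ, ← hR, hh]
    field_simp
  rw [h5]
  rw [neg_div] at h4 h2
  linarith

/-- The terms behave like (l+1)^e 2^{-(p-1)l} / V, and l starts near log₂ V. The series is therefore
dominated by its beginning, of size V^{-(p-1)} (1 + log V)^e / V. -/
theorem sum_tail_le {p : ℝ} (hp : 1 < p) (e : ℕ) :
    ∃ C : ℝ, 0 < C ∧ ∀ V : ℝ, 1 ≤ V → ∀ I : Finset ℕ, (∀ l ∈ I, V < 2 ^ (e + 1 + l)) →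
      ∑ l ∈ I, ((l : ℝ) + 1) ^ e * (2 ^ l / V) * (2 : ℝ) ^ (-p * l) ≤
        C * (V ^ (-p) * (1 + Real.log V) ^ e) := by
  set q : ℝ := (2 : ℝ) ^ (-(p - 1)) with hq
  have hq0 : 0 < q := by positivity
  have hq1 : q < 1 := Real.rpow_lt_one_of_one_lt_of_neg one_lt_two (by linarith)
  have hsum : Summable fun i : ℕ => ((i : ℝ) + 1) ^ e * q ^ i := by
    have h := summable_pow_mul_geometric_of_norm_lt_one e (r := q)
      (by rwa [Real.norm_of_nonneg hq0.le])
    have h2 := (summable_nat_add_iff 1).2 h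
    refine (h2.mul_right q⁻¹).congr fun i => ?_
    push_cast
    rw [pow_succ]
    field_simp
  set S := ∑' i : ℕ, ((i : ℝ) + 1) ^ e * q ^ i with hS
  have hSpos : 0 < S := by
    refine hsum.tsum_pos (fun i => by positivity) 0 (by simp)
  refine ⟨2 ^ e * (q⁻¹ ^ (e + 2)) * S, by positivity, fun V hV I hI => ?_⟩
  obtain ⟨l₀, hl₀, hl₀'⟩ := exists_nat_pow_near hV (one_lt_two (α := ℝ))
  have hVpos : 0 < V := by linarith
  have hge : ∀ l ∈ I, l₀ ≤ l + (e + 1) := fun l hl => by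
    have : (2 : ℝ) ^ l₀ < 2 ^ (e + 1 + l) := hl₀.trans_lt (hI l hl)
    have := (pow_lt_pow_iff_right₀ (one_lt_two (α := ℝ))).1 this
    omega
  have hqV : q ^ l₀ ≤ q⁻¹ * V ^ (-(p - 1)) := by
    have h1 : q * q ^ l₀ ≤ V ^ (-(p - 1)) := by
      rw [← pow_succ', hq, ← Real.rpow_natCast, ← Real.rpow_mul two_pos.le, mul_comm,
        Real.rpow_mul two_pos.le, Real.rpow_natCast]
      exact Real.rpow_le_rpow_of_nonpos hVpos hl₀'.le (by linarith)
    rw [le_inv_mul_iff₀ hq0]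
    exact h1
  have hlog : (l₀ : ℝ) + 1 ≤ 2 * (1 + Real.log V) := by
    have h1 : Real.log (2 ^ l₀) ≤ Real.log V := Real.log_le_log (by positivity) hl₀
    rw [Real.log_pow] at h1
    have h2 := Real.log_two_gt_d9
    have h3 : (0 : ℝ) ≤ l₀ := Nat.cast_nonneg _
    have h4 : 0 ≤ Real.log V := Real.log_nonneg hV
    nlinarith
  have hterm : ∀ l ∈ I, ((l : ℝ) + 1) ^ e * (2 ^ l / V) * (2 : ℝ) ^ (-p * l) ≤
      V⁻¹ * ((l₀ : ℝ) + 1) ^ e * q ^ l₀ * (q⁻¹ ^ (e + 1)) *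
        ((((l + (e + 1) - l₀ : ℕ) : ℝ) + 1) ^ e * q ^ (l + (e + 1) - l₀)) := fun l hl => by
    set i := l + (e + 1) - l₀ with hi
    have hli : l + (e + 1) = i + l₀ := by have := hge l hl; omega
    have h1 : (2 : ℝ) ^ l * (2 : ℝ) ^ (-p * l) = q ^ l := by
      rw [hq, ← Real.rpow_natCast 2 l, ← Real.rpow_add two_pos, ← Real.rpow_natCast _ l,
        ← Real.rpow_mul two_pos.le]
      congr 1; ring
    have h2 : q ^ l = q ^ l₀ * q⁻¹ ^ (e + 1) * q ^ i := by
      have : q ^ l * q ^ (e + 1) = q ^ i * q ^ l₀ := by rw [← pow_add, hli, pow_add]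
      rw [inv_pow]
      field_simp
      linarith
    -- This separates the logarithmic factor, carried by l₀, from a convergent series in the new
    -- index i.
    have h3 : ((l : ℝ) + 1) ^ e ≤ ((l₀ : ℝ) + 1) ^ e * ((i : ℝ) + 1) ^ e := by
      rw [← mul_pow]
      refine pow_le_pow_left₀ (by positivity) ?_ e
      have : (l : ℝ) + (e + 1) = i + l₀ := by exact_mod_cast hli
      have h4 : (0 : ℝ) ≤ i := Nat.cast_nonneg _
      have h5 : (0 : ℝ) ≤ l₀ := Nat.cast_nonneg _
      have h6 : (0 : ℝ) ≤ e := Nat.cast_nonneg _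
      nlinarith
    calc ((l : ℝ) + 1) ^ e * (2 ^ l / V) * (2 : ℝ) ^ (-p * l)
        = V⁻¹ * ((l : ℝ) + 1) ^ e * (2 ^ l * (2 : ℝ) ^ (-p * l)) := by ring
      _ = V⁻¹ * ((l : ℝ) + 1) ^ e * (q ^ l₀ * q⁻¹ ^ (e + 1) * q ^ i) := by rw [h1, h2]
      _ ≤ V⁻¹ * (((l₀ : ℝ) + 1) ^ e * ((i : ℝ) + 1) ^ e) *
          (q ^ l₀ * q⁻¹ ^ (e + 1) * q ^ i) := by gcongr
      _ = _ := by ring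
  have hS' : ∑ l ∈ I, ((((l + (e + 1) - l₀ : ℕ) : ℝ) + 1) ^ e * q ^ (l + (e + 1) - l₀)) ≤ S := by
    have hinj : Set.InjOn (fun l => l + (e + 1) - l₀) (I : Set ℕ) := fun a ha b hb hab => by
      have h1 := hge a ha
      have h2 := hge b hb
      simp only at hab
      omega
    rw [← Finset.sum_image (f := fun i : ℕ => ((i : ℝ) + 1) ^ e * q ^ i) hinj]
    exact hsum.sum_le_tsum _ fun i _ => by positivity
  have hVp : V⁻¹ * V ^ (-(p - 1)) = V ^ (-p) := by
    rw [← Real.rpow_neg_one, ← Real.rpow_add hVpos]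
    congr 1; ring
  calc _ ≤ ∑ l ∈ I, V⁻¹ * ((l₀ : ℝ) + 1) ^ e * q ^ l₀ * (q⁻¹ ^ (e + 1)) *
        ((((l + (e + 1) - l₀ : ℕ) : ℝ) + 1) ^ e * q ^ (l + (e + 1) - l₀)) := Finset.sum_le_sum hterm
    _ ≤ V⁻¹ * ((l₀ : ℝ) + 1) ^ e * q ^ l₀ * (q⁻¹ ^ (e + 1)) * S := by
        rw [← Finset.mul_sum]
        gcongr
    _ ≤ V⁻¹ * (2 * (1 + Real.log V)) ^ e * (q⁻¹ * V ^ (-(p - 1))) * (q⁻¹ ^ (e + 1)) * S := by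
        have hlogV : 0 ≤ Real.log V := Real.log_nonneg hV
        gcongr
    _ = 2 ^ e * (q⁻¹ ^ (e + 2)) * S * ((V⁻¹ * V ^ (-(p - 1))) * (1 + Real.log V) ^ e) := by
        rw [mul_pow]
        ring
    _ = _ := by rw [hVp]

/-- The sum of `∏ (1 + |x_j|)^(-p)` over the nonzero points of an admissible lattice. -/
theorem sum_admissible_le {p : ℝ} (hp : 1 < p) (e : ℕ) :
    ∃ C : ℝ, 0 < C ∧ ∀ V : ℝ, 1 ≤ V → ∀ M : (Fin (e + 1) → ℤ) →+ (Fin (e + 1) → ℝ),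
      (∀ n, n ≠ 0 → V ≤ ∏ j, |M n j|) → ∀ D : Finset (Fin (e + 1) → ℤ), 0 ∉ D →
      ∑ n ∈ D, ∏ j, (1 + |M n j|) ^ (-p) ≤ C * (V ^ (-p) * (1 + Real.log V) ^ e) := by
  obtain ⟨C, hC, hsum⟩ := sum_tail_le hp e
  refine ⟨3 * 4 ^ (e + 1) * C, by positivity, fun V hV M hM D hD => ?_⟩
  have hVpos : 0 < V := by linarith
  choose s hs hs' using fun (n : Fin (e + 1) → ℤ) (j : Fin (e + 1)) =>
    exists_nat_pow_near (show 1 ≤ 1 + |M n j| by linarith [abs_nonneg (M n j)])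
      (one_lt_two (α := ℝ))
  set lev : (Fin (e + 1) → ℤ) → ℕ := fun n => ∑ j, s n j with hlev
  -- Admissibility leaves the low dyadic levels empty.
  have hbig : ∀ n ∈ D, V < 2 ^ (e + 1 + lev n) := fun n hn => by
    have hn0 : n ≠ 0 := fun h => hD (h ▸ hn)
    calc V ≤ ∏ j, |M n j| := hM n hn0
      _ < ∏ j, 2 ^ (s n j + 1) := by
          refine Finset.prod_lt_prod_of_nonempty (fun j _ => ?_) (fun j _ => ?_)
            Finset.univ_nonempty
          · rw [abs_pos]
            intro h0
            have := hM n hn0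
            rw [Finset.prod_eq_zero (Finset.mem_univ j) (by simp [h0])] at this
            linarith
          · linarith [hs' n j]
      _ = 2 ^ (e + 1 + lev n) := by
          rw [Finset.prod_pow_eq_pow_sum, Finset.sum_add_distrib]
          congr 1
          simp [hlev]
          ring
  have hcount : ∀ l, ((D.filter fun n => lev n = l).card : ℝ) ≤
      ((l : ℝ) + 1) ^ e * (3 * 4 ^ (e + 1) * (2 ^ l / V)) := fun l => by
    have h1 : ((D.filter fun n => lev n = l).card : ℝ) =
        ∑ t ∈ Finset.piAntidiag Finset.univ l,
          (((D.filter fun n => lev n = l).filter fun n => s n = t).card : ℝ) := by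
      rw [← Nat.cast_sum, Finset.card_eq_sum_card_fiberwise (f := s)
        (t := Finset.piAntidiag Finset.univ l)]
      intro n hn
      simp only [Finset.coe_filter, Set.mem_ofPred_eq] at hn
      simp only [Finset.mem_coe, Finset.mem_piAntidiag, Finset.mem_univ, implies_true, and_true]
      exact hn.2
    have h2 : ∀ t ∈ Finset.piAntidiag (Finset.univ : Finset (Fin (e + 1))) l,
        (((D.filter fun n => lev n = l).filter fun n => s n = t).card : ℝ) ≤
          3 * 4 ^ (e + 1) * (2 ^ l / V) := fun t ht => by
      rw [Finset.mem_piAntidiag] at ht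
      rcases Finset.eq_empty_or_nonempty ((D.filter fun n => lev n = l).filter fun n => s n = t)
        with h0 | ⟨n, hn⟩
      · rw [h0]
        simp only [Finset.card_empty, Nat.cast_zero]
        positivity
      · have h3 := card_lattice_box_le M hVpos hM (T := fun j => 2 ^ (t j + 1))
          (fun j => by positivity) (D := (D.filter fun n => lev n = l).filter fun n => s n = t)
          (fun n hn j => by
            have h4 := hs' n j
            rw [(Finset.mem_filter.1 hn).2] at h4
            linarith)
        rw [Finset.mem_filter, Finset.mem_filter] at hn
        have h5 := hbig n hn.1.1
        rw [hn.1.2] at h5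
        have h6 : (∏ j : Fin (e + 1), 2 * (2 : ℝ) ^ (t j + 1)) = 4 ^ (e + 1) * 2 ^ l := by
          have : ∀ j : Fin (e + 1), 2 * (2 : ℝ) ^ (t j + 1) = 4 * 2 ^ (t j) := fun j => by ring
          simp only [this, Finset.prod_mul_distrib, Finset.prod_pow_eq_pow_sum, ht.1]
          simp
        rw [h6] at h3
        -- A nonempty block has volume comparable to V at least, so the additive 2 of the box count
        -- is absorbed; hence the factor 3.
        have h7 : 1 ≤ 4 ^ (e + 1) * (2 ^ l / V) := by
          rw [← mul_div_assoc, one_le_div hVpos]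
          refine h5.le.trans ?_
          rw [pow_add]
          gcongr
          norm_num
        rw [mul_div_assoc] at h3
        linarith
    rw [h1]
    refine (Finset.sum_le_sum h2).trans ?_
    rw [Finset.sum_const, nsmul_eq_mul]
    gcongr
    exact_mod_cast card_piAntidiag_le e l
  have hterm : ∀ n, ∏ j, (1 + |M n j|) ^ (-p) ≤ (2 : ℝ) ^ (-p * (lev n : ℝ)) := fun n => by
    have : (2 : ℝ) ^ (-p * (lev n : ℝ)) = ∏ j, ((2 : ℝ) ^ (s n j)) ^ (-p) := by
      rw [Real.finsetProd_rpow _ _ fun _ _ => by positivity, Finset.prod_pow_eq_pow_sum,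
        ← Real.rpow_natCast, ← Real.rpow_mul two_pos.le, mul_comm]
    rw [this]
    refine Finset.prod_le_prod (fun _ _ => by positivity) fun j _ => ?_
    exact Real.rpow_le_rpow_of_nonpos (by positivity) (hs n j) (by linarith)
  calc ∑ n ∈ D, ∏ j, (1 + |M n j|) ^ (-p)
      ≤ ∑ n ∈ D, (2 : ℝ) ^ (-p * (lev n : ℝ)) := Finset.sum_le_sum fun n _ => hterm n
    _ = ∑ l ∈ D.image lev, ∑ n ∈ D with lev n = l, (2 : ℝ) ^ (-p * (lev n : ℝ)) :=
        (Finset.sum_fiberwise_of_maps_to (fun n hn => Finset.mem_image_of_mem _ hn) _).symm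
    _ = ∑ l ∈ D.image lev, ((D.filter fun n => lev n = l).card : ℝ) * (2 : ℝ) ^ (-p * (l : ℝ)) := by
        refine Finset.sum_congr rfl fun l _ => ?_
        rw [← nsmul_eq_mul, ← Finset.sum_const]
        refine Finset.sum_congr rfl fun n hn => ?_
        rw [(Finset.mem_filter.1 hn).2]
    _ ≤ ∑ l ∈ D.image lev, 3 * 4 ^ (e + 1) *
          (((l : ℝ) + 1) ^ e * (2 ^ l / V) * (2 : ℝ) ^ (-p * l)) := by
        refine Finset.sum_le_sum fun l _ => ?_
        refine (mul_le_mul_of_nonneg_right (hcount l) (by positivity)).trans (le_of_eq ?_)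
        ring
    _ ≤ 3 * 4 ^ (e + 1) * (C * (V ^ (-p) * (1 + Real.log V) ^ e)) := by
        rw [← Finset.mul_sum]
        gcongr
        refine hsum V hV _ fun l hl => ?_
        obtain ⟨n, hn, rfl⟩ := Finset.mem_image.1 hl
        exact hbig n hn
    _ = _ := by ring

end LatticeSum

/-! ### Convolution estimates for the smoothness weights -/

section Convolution

theorem one_le_starAbs (k : ℤ) : 1 ≤ starAbs k := le_max_right _ _

theorem starAbs_pos (k : ℤ) : 0 < starAbs k := one_pos.trans_le (one_le_starAbs k)

theorem starAbs_le (k : ℤ) : starAbs k ≤ 1 + |(k : ℝ)| :=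
  max_le (by linarith) (by linarith [abs_nonneg (k : ℝ)])

theorem le_two_mul_starAbs (k : ℤ) : 1 + |(k : ℝ)| ≤ 2 * starAbs k := by
  have h1 := one_le_starAbs k
  have h2 : |(k : ℝ)| ≤ starAbs k := le_max_left _ _
  linarith

theorem starAbs_neg (k : ℤ) : starAbs (-k) = starAbs k := by simp [starAbs]

theorem summable_starAbs {p : ℝ} (hp : 1 < p) : Summable fun k : ℤ => starAbs k ^ (-p) := by
  have h := memℓp_starAbs (r := p / 2) (by linarith)
  have h2 := (memℓp_gen_iff (by norm_num)).1 h
  refine h2.congr fun k => ?_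
  have hk := starAbs_pos k
  rw [Complex.norm_real, Real.norm_of_nonneg (by positivity), ← Real.rpow_mul hk.le]
  congr 1
  simp

/-- Replacing x by its integer part changes |x - k| by at most 1, and the translated sum over ℤ does
not depend on the integer. -/
theorem tsum_shift_le {p : ℝ} (hp : 1 < p) :
    ∃ C : ℝ, 0 < C ∧ ∀ x : ℝ,
      ∑' k : ℤ, ENNReal.ofReal ((1 + |x - k|) ^ (-p)) ≤ ENNReal.ofReal C := by
  have hs := summable_starAbs hp
  have hpos : ∀ k : ℤ, 0 ≤ starAbs k ^ (-p) := fun k => by have := starAbs_pos k; positivity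
  refine ⟨∑' k : ℤ, starAbs k ^ (-p), hs.tsum_pos hpos 0 (by simp [starAbs]), fun x => ?_⟩
  rw [ENNReal.ofReal_tsum_of_nonneg hpos hs,
    ← (Equiv.subLeft ⌊x⌋).tsum_eq fun k => ENNReal.ofReal (starAbs k ^ (-p))]
  refine ENNReal.tsum_le_tsum fun k => ENNReal.ofReal_le_ofReal ?_
  refine Real.rpow_le_rpow_of_nonpos (starAbs_pos _) ?_ (by linarith)
  refine max_le ?_ (by linarith [abs_nonneg (x - k)])
  have h1 := Int.floor_le x
  have h2 := Int.lt_floor_add_one x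
  have h3 : |(⌊x⌋ : ℝ) - x| ≤ 1 := abs_le.2 ⟨by linarith, by linarith⟩
  have h4 := abs_add_le ((⌊x⌋ : ℝ) - x) (x - k)
  simp only [Equiv.subLeft_apply, Int.cast_sub]
  rw [show (⌊x⌋ : ℝ) - k = (⌊x⌋ : ℝ) - x + (x - k) by ring]
  linarith

/-- At least one of a and b is no smaller than c/2. This is what makes a summable power weight
reproduce itself under convolution. -/
theorem rpow_neg_mul_rpow_neg_le {p a b c : ℝ} (hp : 0 ≤ p) (ha : 0 < a) (hb : 0 < b) (hc : 0 < c)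
    (h : c ≤ a + b) :
    a ^ (-p) * b ^ (-p) ≤ 2 ^ p * c ^ (-p) * (a ^ (-p) + b ^ (-p)) := by
  have h1 : c ^ p ≤ 2 ^ p * (a ^ p + b ^ p) := by
    have hm : c ≤ 2 * max a b := by
      have := le_max_left a b
      have := le_max_right a b
      linarith
    calc c ^ p ≤ (2 * max a b) ^ p := Real.rpow_le_rpow hc.le hm hp
      _ = 2 ^ p * (max a b) ^ p := Real.mul_rpow two_pos.le (le_max_of_le_left ha.le)
      _ ≤ _ := by
        refine mul_le_mul_of_nonneg_left ?_ (by positivity)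
        have h2 : 0 ≤ a ^ p := by positivity
        have h3 : 0 ≤ b ^ p := by positivity
        rcases max_choice a b with h | h <;> rw [h] <;> linarith
  rw [Real.rpow_neg ha.le, Real.rpow_neg hb.le, Real.rpow_neg hc.le]
  have h2 : 0 < a ^ p := by positivity
  have h3 : 0 < b ^ p := by positivity
  have h4 : 0 < c ^ p := by positivity
  rw [show (a ^ p)⁻¹ * (b ^ p)⁻¹ = 1 / (a ^ p * b ^ p) by field_simp,
    show 2 ^ p * (c ^ p)⁻¹ * ((a ^ p)⁻¹ + (b ^ p)⁻¹) =
      (2 ^ p * (a ^ p + b ^ p)) / c ^ p / (a ^ p * b ^ p) by field_simp; ring]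
  refine div_le_div_of_nonneg_right ?_ (by positivity)
  rwa [one_le_div h4]

theorem tsum_conv_le {p : ℝ} (hp : 1 < p) :
    ∃ C : ℝ, 0 < C ∧ ∀ x : ℝ,
      ∑' k : ℤ, ENNReal.ofReal (starAbs k ^ (-p) * (1 + |x - k|) ^ (-p)) ≤
        ENNReal.ofReal (C * (1 + |x|) ^ (-p)) := by
  obtain ⟨C, hC, hsum⟩ := tsum_shift_le hp
  have hp0 : 0 ≤ p := by linarith
  refine ⟨2 ^ p * 2 ^ p * (C + C), by positivity, fun x => ?_⟩
  have hterm : ∀ k : ℤ, starAbs k ^ (-p) * (1 + |x - k|) ^ (-p) ≤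
      2 ^ p * 2 ^ p * (1 + |x|) ^ (-p) * ((1 + |0 - (k : ℝ)|) ^ (-p) + (1 + |x - k|) ^ (-p)) := by
    intro k
    have h0 := starAbs_pos k
    have h1 : starAbs k ^ (-p) ≤ 2 ^ p * (1 + |(k : ℝ)|) ^ (-p) := by
      have : ((1 + |(k : ℝ)|) / 2) ^ (-p) = 2 ^ p * (1 + |(k : ℝ)|) ^ (-p) := by
        rw [Real.div_rpow (by positivity) two_pos.le, Real.rpow_neg two_pos.le,
          div_inv_eq_mul, mul_comm]
      rw [← this]
      refine Real.rpow_le_rpow_of_nonpos (by positivity) ?_ (by linarith)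
      linarith [le_two_mul_starAbs k]
    have h2 := rpow_neg_mul_rpow_neg_le (p := p) (a := 1 + |(k : ℝ)|) (b := 1 + |x - k|)
      (c := 1 + |x|) hp0 (by positivity) (by positivity) (by positivity) (by
        have := abs_add_le (k : ℝ) (x - k)
        rw [show (k : ℝ) + (x - k) = x by ring] at this
        linarith)
    rw [zero_sub, abs_neg]
    calc _ ≤ (2 ^ p * (1 + |(k : ℝ)|) ^ (-p)) * (1 + |x - k|) ^ (-p) := by gcongr
      _ = 2 ^ p * ((1 + |(k : ℝ)|) ^ (-p) * (1 + |x - k|) ^ (-p)) := by ring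
      _ ≤ 2 ^ p * (2 ^ p * (1 + |x|) ^ (-p) *
            ((1 + |(k : ℝ)|) ^ (-p) + (1 + |x - k|) ^ (-p))) := by gcongr
      _ = _ := by ring
  calc _ ≤ ∑' k : ℤ, ENNReal.ofReal (2 ^ p * 2 ^ p * (1 + |x|) ^ (-p)) *
        (ENNReal.ofReal ((1 + |0 - (k : ℝ)|) ^ (-p)) + ENNReal.ofReal ((1 + |x - k|) ^ (-p))) := by
        refine ENNReal.tsum_le_tsum fun k => ?_
        rw [← ENNReal.ofReal_add (by positivity) (by positivity),
          ← ENNReal.ofReal_mul (by positivity)]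
        exact ENNReal.ofReal_le_ofReal (hterm k)
    _ ≤ ENNReal.ofReal (2 ^ p * 2 ^ p * (1 + |x|) ^ (-p)) *
          (ENNReal.ofReal C + ENNReal.ofReal C) := by
        rw [ENNReal.tsum_mul_left, ENNReal.tsum_add]
        gcongr
        · exact hsum 0
        · exact hsum x
    _ = _ := by
        rw [← ENNReal.ofReal_add hC.le hC.le, ← ENNReal.ofReal_mul (by positivity)]
        congr 1; ring

/-- A finite set of multi-indices lies in the product of its projections, where the sum factorizes.
-/
theorem tsum_prod_le_prod_tsum {ι κ : Type*} [Fintype ι] [DecidableEq ι] [DecidableEq κ]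
    (f : ι → κ → ℝ≥0∞) :
    ∑' k : ι → κ, ∏ j, f j (k j) ≤ ∏ j, ∑' k, f j k := by
  rw [ENNReal.tsum_eq_iSup_sum]
  refine iSup_le fun s => ?_
  calc ∑ k ∈ s, ∏ j, f j (k j)
      ≤ ∑ k ∈ Fintype.piFinset (fun j => s.image fun k => k j), ∏ j, f j (k j) := by
        refine Finset.sum_le_sum_of_subset fun k hk => ?_
        rw [Fintype.mem_piFinset]
        exact fun j => Finset.mem_image_of_mem (fun k : ι → κ => k j) hk
    _ = ∏ j, ∑ k ∈ s.image (fun k => k j), f j k := (Finset.prod_univ_sum _ _).symm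
    _ ≤ _ := Finset.prod_le_prod' fun j _ => ENNReal.sum_le_tsum _

/-- The weight `∏ (k_j^*)^(-p)`. -/
noncomputable def mixedWeight {d : ℕ} (p : ℝ) (k : Fin d → ℤ) : ℝ := ∏ j, starAbs (k j) ^ (-p)

theorem mixedWeight_pos {d : ℕ} (p : ℝ) (k : Fin d → ℤ) : 0 < mixedWeight p k :=
  Finset.prod_pos fun _ _ => Real.rpow_pos_of_pos (starAbs_pos _) _

theorem mixedWeight_mul {d : ℕ} (p q : ℝ) (k : Fin d → ℤ) :
    mixedWeight p k * mixedWeight q k = mixedWeight (p + q) k := by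
  simp only [mixedWeight, ← Finset.prod_mul_distrib]
  refine Finset.prod_congr rfl fun j _ => ?_
  rw [← Real.rpow_add (starAbs_pos _)]
  congr 1; ring

theorem mixedWeight_zero {d : ℕ} (p : ℝ) : mixedWeight p (0 : Fin d → ℤ) = 1 := by
  simp [mixedWeight, starAbs]

theorem tsum_mixedWeight_conv_le {p : ℝ} (hp : 1 < p) (d : ℕ) :
    ∃ C : ℝ, 0 < C ∧ ∀ x : Fin d → ℝ,
      ∑' k : Fin d → ℤ, ENNReal.ofReal (mixedWeight p k * ∏ j, (1 + |x j - k j|) ^ (-p)) ≤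
        ENNReal.ofReal (C * ∏ j, (1 + |x j|) ^ (-p)) := by
  obtain ⟨C, hC, hsum⟩ := tsum_conv_le hp
  refine ⟨C ^ d, by positivity, fun x => ?_⟩
  have h : ∀ k : Fin d → ℤ, ENNReal.ofReal (mixedWeight p k * ∏ j, (1 + |x j - k j|) ^ (-p)) =
      ∏ j, ENNReal.ofReal (starAbs (k j) ^ (-p) * (1 + |x j - k j|) ^ (-p)) := fun k => by
    rw [mixedWeight, ← Finset.prod_mul_distrib, ENNReal.ofReal_prod_of_nonneg]
    intro j _
    have := starAbs_pos (k j)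
    positivity
  simp_rw [h]
  refine (tsum_prod_le_prod_tsum fun j (k : ℤ) =>
    ENNReal.ofReal (starAbs k ^ (-p) * (1 + |x j - k|) ^ (-p))).trans ?_
  refine (Finset.prod_le_prod' fun j _ => hsum (x j)).trans (le_of_eq ?_)
  rw [← ENNReal.ofReal_prod_of_nonneg fun j _ => by positivity, Finset.prod_mul_distrib]
  simp

/-- Collapses a sum over pairs of frequencies to a sum over their difference k. -/
theorem tsum_mixedWeight_add_le {p : ℝ} (hp : 1 < p) (d : ℕ) :
    ∃ C : ℝ, 0 < C ∧ ∀ k : Fin d → ℤ,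
      ∑' l : Fin d → ℤ, ENNReal.ofReal (mixedWeight p l * mixedWeight p (k + l)) ≤
        ENNReal.ofReal (C * mixedWeight p k) := by
  obtain ⟨C, hC, hsum⟩ := tsum_mixedWeight_conv_le hp d
  refine ⟨(2 ^ p) ^ d * C, by positivity, fun k => ?_⟩
  have h1 : ∀ l : Fin d → ℤ, mixedWeight p l * mixedWeight p (k + l) ≤
      (2 ^ p) ^ d * (mixedWeight p l * ∏ j, (1 + |((-k j : ℤ) : ℝ) - l j|) ^ (-p)) := fun l => by
    have h2 : mixedWeight p (k + l) ≤
        ∏ j, 2 ^ p * (1 + |((-k j : ℤ) : ℝ) - l j|) ^ (-p) := by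
      refine Finset.prod_le_prod (fun j _ => Real.rpow_nonneg (starAbs_pos _).le _) fun j _ => ?_
      have h3 : |((-k j : ℤ) : ℝ) - l j| = |(((k + l) j : ℤ) : ℝ)| := by
        rw [← abs_neg]
        congr 1
        push_cast [Pi.add_apply]
        ring
      rw [h3]
      have : ((1 + |(((k + l) j : ℤ) : ℝ)|) / 2) ^ (-p) =
          2 ^ p * (1 + |(((k + l) j : ℤ) : ℝ)|) ^ (-p) := by
        rw [Real.div_rpow (by positivity) two_pos.le, Real.rpow_neg two_pos.le, div_inv_eq_mul,
          mul_comm]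
      rw [← this]
      refine Real.rpow_le_rpow_of_nonpos (by positivity) ?_ (by linarith)
      linarith [le_two_mul_starAbs ((k + l) j)]
    rw [Finset.prod_mul_distrib] at h2
    simp only [Finset.prod_const, Finset.card_univ, Fintype.card_fin] at h2
    calc _ ≤ mixedWeight p l * ((2 ^ p) ^ d * ∏ j, (1 + |((-k j : ℤ) : ℝ) - l j|) ^ (-p)) :=
          mul_le_mul_of_nonneg_left h2 (mixedWeight_pos _ _).le
      _ = _ := by ring
  calc _ ≤ ∑' l : Fin d → ℤ, ENNReal.ofReal ((2 ^ p) ^ d) * ENNReal.ofReal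
          (mixedWeight p l * ∏ j, (1 + |((-k j : ℤ) : ℝ) - l j|) ^ (-p)) := by
        refine ENNReal.tsum_le_tsum fun l => ?_
        rw [← ENNReal.ofReal_mul (by positivity)]
        exact ENNReal.ofReal_le_ofReal (h1 l)
    _ ≤ ENNReal.ofReal ((2 ^ p) ^ d) *
          ENNReal.ofReal (C * ∏ j, (1 + |((-k j : ℤ) : ℝ)|) ^ (-p)) := by
        rw [ENNReal.tsum_mul_left]
        gcongr
        exact hsum _
    _ ≤ _ := by
        rw [← ENNReal.ofReal_mul (by positivity), mul_assoc]
        refine ENNReal.ofReal_le_ofReal ?_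
        gcongr
        refine Finset.prod_le_prod (fun j _ => by positivity) fun j _ => ?_
        refine Real.rpow_le_rpow_of_nonpos (starAbs_pos _) ?_ (by linarith)
        rw [← starAbs_neg]
        exact starAbs_le _

end Convolution

/-! ### A smooth window and its Fourier transform -/

section Window

open Complex Filter

/-- A smooth function supported in `[-1, 1]` whose integer translates sum to `1`. -/
noncomputable def window (x : ℝ) : ℝ := Real.smoothTransition (x + 1) - Real.smoothTransition x

theorem contDiff_window {n : ℕ∞} : ContDiff ℝ n window := by
  unfold window
  exact (Real.smoothTransition.contDiff.comp (contDiff_id.add contDiff_const)).sub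
    Real.smoothTransition.contDiff

theorem continuous_window : Continuous window := (contDiff_window (n := 0)).continuous

theorem window_eq_zero {x : ℝ} (hx : 1 ≤ |x|) : window x = 0 := by
  rw [window]
  rcases le_abs.1 hx with h | h
  · rw [Real.smoothTransition.one_of_one_le h, Real.smoothTransition.one_of_one_le (by linarith),
      sub_self]
  · rw [Real.smoothTransition.zero_of_nonpos (by linarith),
      Real.smoothTransition.zero_of_nonpos (by linarith), sub_self]

theorem hasCompactSupport_window : HasCompactSupport window := by
  refine HasCompactSupport.intro (isCompact_Icc (a := (-1 : ℝ)) (b := 1)) fun x hx => ?_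
  refine window_eq_zero (not_lt.1 fun h => hx ?_)
  exact ⟨(abs_lt.1 h).1.le, (abs_lt.1 h).2.le⟩

/-- The Fourier transform of `window`, with the sign convention `exp (2πi ηx)`. -/
noncomputable def windowFourier (η : ℝ) : ℂ := ∫ x, (window x : ℂ) * exp (2 * Real.pi * I * η * x)

theorem integral_exp_int (k : ℤ) :
    ∫ x in (0 : ℝ)..1, exp (2 * Real.pi * I * k * x) = if k = 0 then 1 else 0 := by
  split_ifs with h
  · simp [h]
  · have hc : 2 * Real.pi * I * k ≠ 0 := by
      simp [Real.pi_ne_zero, h]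
    rw [integral_exp_mul_complex hc]
    have : exp (2 * Real.pi * I * k * (1 : ℝ)) = 1 := by
      rw [Complex.exp_eq_one_iff]
      exact ⟨k, by push_cast; ring⟩
    rw [this]
    simp

/-- Folding the integral over [-1, 1] onto [0, 1] replaces the window by the sum of its translates,
which is 1. -/
theorem windowFourier_int (k : ℤ) : windowFourier k = if k = 0 then 1 else 0 := by
  set f : ℝ → ℂ := fun x => (window x : ℂ) * exp (2 * Real.pi * I * k * x) with hf
  have hcont : Continuous f := by
    have := continuous_window
    fun_prop
  have h1 : windowFourier k = ∫ x in (-1 : ℝ)..1, f x := by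
    rw [windowFourier, intervalIntegral.integral_eq_integral_of_support_subset]
    · push_cast
      rfl
    · intro x hx
      have hx' : window x ≠ 0 := fun h => hx (by simp [hf, h])
      have h2 : |x| < 1 := not_le.1 fun h => hx' (window_eq_zero h)
      exact ⟨(abs_lt.1 h2).1, (abs_lt.1 h2).2.le⟩
  have h2 : ∫ x in (-1 : ℝ)..0, f x = ∫ x in (0 : ℝ)..1, f (x - 1) := by
    rw [intervalIntegral.integral_comp_sub_right]
    norm_num
  have h3 : ∀ x ∈ Set.uIcc (0 : ℝ) 1, f (x - 1) + f x = exp (2 * Real.pi * I * k * x) := by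
    intro x hx
    rw [Set.uIcc_of_le zero_le_one] at hx
    have he : exp (2 * Real.pi * I * k * ((x - 1 : ℝ) : ℂ)) = exp (2 * Real.pi * I * k * x) := by
      rw [Complex.exp_eq_exp_iff_exists_int]
      exact ⟨-k, by push_cast; ring⟩
    have hw : window (x - 1) + window x = 1 := by
      rw [window, window, Real.smoothTransition.zero_of_nonpos (x := x - 1) (by linarith [hx.2]),
        Real.smoothTransition.one_of_one_le (x := x + 1) (by linarith [hx.1])]
      ring_nf
    simp only [hf]
    rw [he, ← add_mul, ← Complex.ofReal_add, hw]
    simp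
  have hcont' : Continuous fun x => f (x - 1) := hcont.comp (continuous_id.sub continuous_const)
  rw [h1, ← intervalIntegral.integral_add_adjacent_intervals
    (hcont.intervalIntegrable (-1) 0) (hcont.intervalIntegrable 0 1), h2,
    ← intervalIntegral.integral_add (hcont'.intervalIntegrable 0 1) (hcont.intervalIntegrable 0 1),
    intervalIntegral.integral_congr h3, integral_exp_int]

/-- The window is smooth with compact support, so its Fourier transform is a Schwartz function and
decays faster than any power. -/
theorem windowFourier_decay (p : ℝ) :
    ∃ C : ℝ, 0 < C ∧ ∀ η : ℝ, ‖windowFourier η‖ ^ 2 ≤ C * (1 + |η|) ^ (-p) := by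
  have hcs : HasCompactSupport fun x : ℝ => (window x : ℂ) :=
    hasCompactSupport_window.comp_left (g := fun y : ℝ => (y : ℂ)) ofReal_zero
  have hcd : ContDiff ℝ (⊤ : ℕ∞) fun x : ℝ => (window x : ℂ) :=
    ofRealCLM.contDiff.comp contDiff_window
  set f : SchwartzMap ℝ ℂ := hcs.toSchwartzMap hcd with hf
  have hF : ∀ η : ℝ, windowFourier η = (FourierTransform.fourier f : SchwartzMap ℝ ℂ) (-η) := by
    intro η
    rw [SchwartzMap.fourier_coe, Real.fourier_real_eq_integral_exp_smul, windowFourier]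
    refine MeasureTheory.integral_congr_ae (Eventually.of_forall fun x => ?_)
    simp only [hf, HasCompactSupport.toSchwartzMap_toFun, smul_eq_mul]
    rw [mul_comm]
    congr 2
    push_cast
    ring
  obtain ⟨N, hN⟩ := exists_nat_ge p
  have hb := fun η : ℝ => SchwartzMap.one_add_le_sup_seminorm_apply (𝕜 := ℝ) (m := (N, 0))
    (k := N) (n := 0) le_rfl le_rfl (FourierTransform.fourier f : SchwartzMap ℝ ℂ) (-η)
  simp only [norm_iteratedFDeriv_zero, ← hF, norm_neg, Real.norm_eq_abs] at hb
  set B := 2 ^ N * (Finset.Iic (N, 0)).sup (fun m => SchwartzMap.seminorm ℝ m.1 m.2)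
    (FourierTransform.fourier f : SchwartzMap ℝ ℂ) with hB
  have hB0 : 0 ≤ B := le_trans (by positivity) (hb 0)
  refine ⟨(B + 1) ^ 2, by positivity, fun η => ?_⟩
  have h1 : (1 : ℝ) ≤ 1 + |η| := by linarith [abs_nonneg η]
  have h2 : ((1 + |η|) ^ N * ‖windowFourier η‖) ^ 2 ≤ (B + 1) ^ 2 :=
    pow_le_pow_left₀ (by positivity) ((hb η).trans (by linarith)) 2
  have h3 : (1 + |η|) ^ p ≤ ((1 + |η|) ^ N) ^ 2 := by
    rw [← pow_mul, ← Real.rpow_natCast]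
    refine Real.rpow_le_rpow_of_exponent_le h1 ?_
    push_cast
    have : (0 : ℝ) ≤ N := Nat.cast_nonneg _
    linarith
  rw [Real.rpow_neg (by positivity), ← div_eq_mul_inv, le_div_iff₀ (by positivity)]
  calc ‖windowFourier η‖ ^ 2 * (1 + |η|) ^ p ≤ ‖windowFourier η‖ ^ 2 * ((1 + |η|) ^ N) ^ 2 := by
        gcongr
    _ = ((1 + |η|) ^ N * ‖windowFourier η‖) ^ 2 := by ring
    _ ≤ _ := h2

end Window

/-! ### Randomly shifted lattice cubature and Parseval in the shift -/

section Parseval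

open Complex Matrix

/-- The character `y ↦ exp (2πi ξ·y)` of `ℝ^d`. -/
noncomputable def character {d : ℕ} (ξ y : Fin d → ℝ) : ℂ := exp (2 * Real.pi * I * (ξ ⬝ᵥ y : ℝ))

theorem continuous_character {d : ℕ} (ξ : Fin d → ℝ) : Continuous (character ξ) := by
  unfold character dotProduct
  fun_prop

theorem character_eq_prod {d : ℕ} (ξ y : Fin d → ℝ) :
    character ξ y = ∏ j, exp (2 * Real.pi * I * ξ j * y j) := by
  rw [character, dotProduct, ← Complex.exp_sum]
  congr 1
  push_cast
  rw [Finset.mul_sum]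
  exact Finset.sum_congr rfl fun j _ => by ring

theorem character_add_int {d : ℕ} (n z : Fin d → ℤ) (y : Fin d → ℝ) :
    character (fun j => (n j : ℝ)) ((fun j => (z j : ℝ)) + y) =
      character (fun j => (n j : ℝ)) y := by
  rw [character, character, dotProduct_add, Complex.exp_eq_exp_iff_exists_int]
  refine ⟨∑ j, n j * z j, ?_⟩
  simp only [dotProduct]
  push_cast
  ring

theorem character_mul {d : ℕ} (ξ ξ' y : Fin d → ℝ) :
    character ξ y * character ξ' y = character (ξ + ξ') y := by
  rw [character, character, character, ← Complex.exp_add, add_dotProduct]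
  congr 1
  push_cast
  ring

/-- The unit cube `(0, 1]^d`. -/
def unitCube (d : ℕ) : Set (Fin d → ℝ) :=
  {x | ∀ i, x i ∈ Set.Ioc ((0 : Fin d → ℝ) i) ((0 : Fin d → ℝ) i + 1)}

theorem measurableSet_unitCube (d : ℕ) : MeasurableSet (unitCube d) := by
  unfold unitCube
  have : {x : Fin d → ℝ | ∀ i, x i ∈ Set.Ioc ((0 : Fin d → ℝ) i) ((0 : Fin d → ℝ) i + 1)} =
      Set.univ.pi fun i => Set.Ioc ((0 : Fin d → ℝ) i) ((0 : Fin d → ℝ) i + 1) := by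
    ext; simp
  rw [this]
  exact MeasurableSet.univ_pi fun _ => measurableSet_Ioc

theorem volume_unitCube (d : ℕ) : volume (unitCube d) = 1 := by
  unfold unitCube
  have : {x : Fin d → ℝ | ∀ i, x i ∈ Set.Ioc ((0 : Fin d → ℝ) i) ((0 : Fin d → ℝ) i + 1)} =
      Set.univ.pi fun i => Set.Ioc ((0 : Fin d → ℝ) i) ((0 : Fin d → ℝ) i + 1) := by
    ext; simp
  rw [this, volume_pi, Measure.pi_pi]
  simp

instance isProbabilityMeasure_unitCube (d : ℕ) :
    IsProbabilityMeasure (volume.restrict (unitCube d)) :=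
  ⟨by rw [Measure.restrict_apply_univ, volume_unitCube]⟩

section

noncomputable local instance : MeasureSpace UnitAddCircle := ⟨AddCircle.haarAddCircle⟩

local instance : Measure.IsAddHaarMeasure (volume : Measure UnitAddCircle) :=
  inferInstanceAs (Measure.IsAddHaarMeasure AddCircle.haarAddCircle)

local instance : IsProbabilityMeasure (volume : Measure UnitAddCircle) :=
  inferInstanceAs (IsProbabilityMeasure AddCircle.haarAddCircle)

/-- Parseval's identity on the unit cube. -/
theorem parseval_unitCube {d : ℕ} {h : (Fin d → ℝ) → ℂ} (hm : Measurable h)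
    (h2 : MemLp h 2 (volume.restrict (unitCube d))) :
    ∫⁻ u in unitCube d, ENNReal.ofReal (‖h u‖ ^ 2) =
      ∑' n : Fin d → ℤ, ENNReal.ofReal
        (‖∫ u in unitCube d, character (fun j => (n j : ℝ)) (-u) * h u‖ ^ 2) := by
  set ρ : UnitAddTorus (Fin d) → (Fin d → ℝ) :=
    fun t => (UnitAddTorus.measurableEquivPiIoc (0 : Fin d → ℝ) t).1 with hρ
  have hmp : MeasurePreserving ρ volume (volume.restrict (unitCube d)) :=
    (measurePreserving_subtype_coe (measurableSet_unitCube d)).comp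
      (UnitAddTorus.measurePreserving_equivPiIoc (0 : Fin d → ℝ))
  have hρ' : ∀ u ∈ unitCube d, ρ (fun i => (u i : UnitAddCircle)) = u := fun u hu => by
    have := (UnitAddTorus.measurableEquivPiIoc (0 : Fin d → ℝ)).apply_symm_apply ⟨u, hu⟩
    exact congrArg Subtype.val this
  have hmem : MemLp (h ∘ ρ) 2 volume := h2.comp_measurePreserving hmp
  have hP := UnitAddTorus.hasSum_sq_mFourierCoeff hmem.toLp
  have hcoe := hmem.coeFn_toLp
  have hint : ∫ t, ‖hmem.toLp (h ∘ ρ) t‖ ^ 2 = ∫ t, ‖h (ρ t)‖ ^ 2 :=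
    integral_congr_ae (by filter_upwards [hcoe] with t ht; rw [ht]; rfl)
  have hcoef : ∀ n : Fin d → ℤ, UnitAddTorus.mFourierCoeff (hmem.toLp (h ∘ ρ)) n =
      ∫ u in unitCube d, character (fun j => (n j : ℝ)) (-u) * h u := fun n => by
    have h1 : UnitAddTorus.mFourierCoeff (hmem.toLp (h ∘ ρ)) n =
        UnitAddTorus.mFourierCoeff (h ∘ ρ) n :=
      integral_congr_ae (by filter_upwards [hcoe] with t ht; rw [ht])
    rw [h1, UnitAddTorus.mFourierCoeff_eq_integral (h ∘ ρ) n 0]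
    refine setIntegral_congr_fun (measurableSet_unitCube d) fun u hu => ?_
    simp only [Function.comp_apply, hρ' u hu, smul_eq_mul]
    congr 1
    rw [character_eq_prod, UnitAddTorus.mFourier, ContinuousMap.coe_mk]
    refine Finset.prod_congr rfl fun j _ => ?_
    rw [fourier_coe_apply]
    congr 1
    simp
  rw [hint] at hP
  simp_rw [hcoef] at hP
  have hi : Integrable (fun t => ‖h (ρ t)‖ ^ 2) (volume : Measure (UnitAddTorus (Fin d))) := by
    simpa using hmem.integrable_norm_pow (by norm_num)
  rw [← ENNReal.ofReal_tsum_of_nonneg (fun n => by positivity) hP.summable, hP.tsum_eq,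
    ofReal_integral_eq_lintegral_ofReal hi (Filter.Eventually.of_forall fun t => by positivity)]
  rw [hmp.lintegral_comp (f := fun u => ENNReal.ofReal (‖h u‖ ^ 2)) (by fun_prop)]

end

/-- Unfolding: an integral over `ℝ^d` as an integral over the unit cube of a sum over `ℤ^d`. -/
theorem integral_eq_sum_unitCube {d : ℕ} {G : (Fin d → ℝ) → ℂ} (hG : Integrable G)
    (Z : Finset (Fin d → ℤ))
    (hZ : ∀ z ∉ Z, ∀ u ∈ unitCube d, G ((fun j => (z j : ℝ)) + u) = 0) :
    ∫ x, G x = ∫ u in unitCube d, ∑ z ∈ Z, G ((fun j => (z j : ℝ)) + u) := by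
  -- Integer translates of the cube tile the space. As the cube is half-open on the left, x belongs
  -- to the tile with index ⌈x⌉ - 1.
  set s : (Fin d → ℤ) → Set (Fin d → ℝ) := fun z =>
    (fun x => (fun j => (-z j : ℝ)) + x) ⁻¹' unitCube d with hs
  have hmem : ∀ z x, x ∈ s z ↔ ∀ j, z j = ⌈x j⌉ - 1 := fun z x => by
    simp only [hs, unitCube, Set.mem_preimage, Set.mem_ofPred_eq, Pi.add_apply, Set.mem_Ioc,
      Pi.zero_apply]
    refine forall_congr' fun j => ?_
    rw [eq_sub_iff_add_eq, eq_comm, Int.ceil_eq_iff]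
    push_cast
    constructor
    · rintro ⟨h1, h2⟩
      constructor <;> linarith
    · rintro ⟨h1, h2⟩
      constructor <;> linarith
  have hun : ⋃ z, s z = Set.univ := by
    refine Set.eq_univ_of_forall fun x => Set.mem_iUnion.2 ⟨fun j => ⌈x j⌉ - 1, ?_⟩
    exact (hmem _ _).2 fun j => rfl
  have hdisj : Pairwise (Function.onFun Disjoint s) := fun z z' hne =>
    Set.disjoint_left.2 fun x hx hx' => hne (by
      funext j
      rw [(hmem _ _).1 hx j, (hmem _ _).1 hx' j])
  have hmeas : ∀ z, MeasurableSet (s z) := fun z =>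
    (measurable_const_add _) (measurableSet_unitCube d)
  have hsum := hasSum_integral_iUnion hmeas hdisj (hG.integrableOn (s := ⋃ z, s z))
  rw [hun, setIntegral_univ] at hsum
  have hpiece : ∀ z, ∫ x in s z, G x = ∫ u in unitCube d, G ((fun j => (z j : ℝ)) + u) := fun z => by
    have hmp := measurePreserving_add_left (volume : Measure (Fin d → ℝ)) (fun j => (-z j : ℝ))
    have hemb : MeasurableEmbedding (fun x : Fin d → ℝ => (fun j => (-z j : ℝ)) + x) :=
      (MeasurableEquiv.addLeft (fun j => (-z j : ℝ))).measurableEmbedding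
    rw [← hmp.setIntegral_preimage_emb hemb
      (fun u => G ((fun j => (z j : ℝ)) + u)) (unitCube d)]
    refine integral_congr_ae (Filter.Eventually.of_forall fun x => ?_)
    simp only
    congr 1
    funext j
    simp
  simp_rw [hpiece] at hsum
  have hzero : ∀ z ∉ Z, ∫ u in unitCube d, G ((fun j => (z j : ℝ)) + u) = 0 := fun z hz =>
    (setIntegral_congr_fun (measurableSet_unitCube d) fun u hu => hZ z hz u hu).trans (by simp)
  rw [hsum.unique (hasSum_sum_of_ne_finset_zero hzero), integral_finsetSum]
  exact fun z _ => (hG.comp_add_left _).integrableOn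

/-- The tensor product window. -/
noncomputable def multiWindow {d : ℕ} (y : Fin d → ℝ) : ℝ := ∏ j, window (y j)

theorem continuous_multiWindow {d : ℕ} : Continuous (multiWindow (d := d)) :=
  continuous_finsetProd _ fun j _ => continuous_window.comp (continuous_apply j)

theorem multiWindow_eq_zero {d : ℕ} {y : Fin d → ℝ} {j : Fin d} (h : 1 ≤ |y j|) :
    multiWindow y = 0 :=
  Finset.prod_eq_zero (Finset.mem_univ j) (window_eq_zero h)

theorem hasCompactSupport_multiWindow {d : ℕ} : HasCompactSupport (multiWindow (d := d)) := by
  refine HasCompactSupport.intro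
    (isCompact_univ_pi fun _ : Fin d => isCompact_Icc (a := (-1 : ℝ)) (b := 1)) fun x hx => ?_
  simp only [Set.mem_pi, Set.mem_univ, true_imp_iff, not_forall] at hx
  obtain ⟨j, hj⟩ := hx
  refine multiWindow_eq_zero (j := j) (not_lt.1 fun h => hj ?_)
  exact ⟨(abs_lt.1 h).1.le, (abs_lt.1 h).2.le⟩

theorem integral_multiWindow {d : ℕ} (ξ : Fin d → ℝ) :
    ∫ y, (multiWindow y : ℂ) * character ξ y = ∏ j, windowFourier (ξ j) := by
  simp only [multiWindow, character_eq_prod, ofReal_prod, ← Finset.prod_mul_distrib]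
  rw [integral_fintype_prod_volume_eq_prod
    (f := fun j (x : ℝ) => (window x : ℂ) * exp (2 * Real.pi * I * ξ j * x))]
  rfl

/-- The value of the cubature formula with nodes `B⁻ᵀ(z + u)`, `z ∈ Z`, at the character `k`. -/
noncomputable def shiftedCubature {d : ℕ} (B : Matrix (Fin d) (Fin d) ℝ) (Z : Finset (Fin d → ℤ))
    (k : Fin d → ℤ) (u : Fin d → ℝ) : ℂ :=
  ∑ z ∈ Z, ((|B.det|⁻¹ * multiWindow (Bᵀ⁻¹ *ᵥ ((fun j => (z j : ℝ)) + u)) : ℝ) : ℂ) *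
    character (fun j => (k j : ℝ)) (Bᵀ⁻¹ *ᵥ ((fun j => (z j : ℝ)) + u))

theorem continuous_shiftedCubature {d : ℕ} (B : Matrix (Fin d) (Fin d) ℝ)
    (Z : Finset (Fin d → ℤ)) (k : Fin d → ℤ) : Continuous (shiftedCubature B Z k) := by
  unfold shiftedCubature
  have h1 := continuous_multiWindow (d := d)
  have h2 := continuous_character (fun j => (k j : ℝ))
  have h3 : ∀ z : Fin d → ℤ,
      Continuous fun u : Fin d → ℝ => Bᵀ⁻¹ *ᵥ ((fun j => (z j : ℝ)) + u) := fun z =>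
    Continuous.matrix_mulVec continuous_const (continuous_const.add continuous_id)
  refine continuous_finsetSum _ fun z _ => ?_
  exact (continuous_ofReal.comp (continuous_const.mul (h1.comp (h3 z)))).mul (h2.comp (h3 z))

/-- Characters with integer frequency do not see integer translations, so the cube integral of the
sum over z unfolds to the whole space. The substitution v = Bᵀy then turns (n, v) into (Bn, y) and
leaves the Fourier transform of the window at k - Bn. -/
theorem integral_shiftedCubature {d : ℕ} {B : Matrix (Fin d) (Fin d) ℝ} (hB : B.det ≠ 0)
    {Z : Finset (Fin d → ℤ)}
    (hZ : ∀ z ∉ Z, ∀ u ∈ unitCube d, multiWindow (Bᵀ⁻¹ *ᵥ ((fun j => (z j : ℝ)) + u)) = 0)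
    (k n : Fin d → ℤ) :
    ∫ u in unitCube d, character (fun j => (n j : ℝ)) (-u) * shiftedCubature B Z k u =
      ∏ j, windowFourier (k j - (B *ᵥ fun i => (n i : ℝ)) j) := by
  have hBt : Bᵀ.det ≠ 0 := by rwa [det_transpose]
  have hunit : IsUnit Bᵀ.det := isUnit_iff_ne_zero.2 hBt
  set G : (Fin d → ℝ) → ℂ := fun v => ((|B.det|⁻¹ * multiWindow (Bᵀ⁻¹ *ᵥ v) : ℝ) : ℂ) *
    character (fun j => (k j : ℝ)) (Bᵀ⁻¹ *ᵥ v) * character (fun j => (n j : ℝ)) (-v) with hG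
  set F : (Fin d → ℝ) → ℂ := fun y => (|B.det|⁻¹ : ℝ) * ((multiWindow y : ℂ) *
    character ((fun j => (k j : ℝ)) - B *ᵥ fun i => (n i : ℝ)) y) with hF
  have hFG : ∀ y, G (Bᵀ *ᵥ y) = F y := fun y => by
    simp only [hG, hF, mulVec_mulVec, nonsing_inv_mul _ hunit, one_mulVec]
    have h1 : character (fun j => (n j : ℝ)) (-(Bᵀ *ᵥ y)) =
        character (-(B *ᵥ fun i => (n i : ℝ))) y := by
      rw [character, character, neg_dotProduct, dotProduct_neg, dotProduct_mulVec,
        vecMul_transpose]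
    rw [h1, mul_assoc, character_mul, ← sub_eq_add_neg]
    push_cast
    ring
  have hFint : Integrable F := by
    refine Continuous.integrable_of_hasCompactSupport ?_ ?_
    · exact continuous_const.mul ((continuous_ofReal.comp continuous_multiWindow).mul
        (continuous_character _))
    · refine hasCompactSupport_multiWindow.mono fun y hy => ?_
      rw [Function.mem_support] at hy ⊢
      exact fun h => hy (by simp [hF, h])
  have hmap := Real.map_matrix_volume_pi_eq_smul_volume_pi hBt
  have hemb : MeasurableEmbedding (toLin' Bᵀ : (Fin d → ℝ) → (Fin d → ℝ)) := by
    have hc : Continuous (toLin' Bᵀ) := LinearMap.continuous_of_finiteDimensional _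
    refine hc.measurableEmbedding fun x y hxy => ?_
    have h1 := congrArg (fun w => Bᵀ⁻¹ *ᵥ w) hxy
    simpa only [toLin'_apply, mulVec_mulVec, nonsing_inv_mul _ hunit, one_mulVec] using h1
  have hdet : (0 : ℝ) < |B.det| := abs_pos.2 hB
  -- The Jacobian |det B| cancels the normalization of the cubature weights.
  have hvol : (volume : Measure (Fin d → ℝ)) =
      ENNReal.ofReal |B.det| • Measure.map (toLin' Bᵀ) volume := by
    rw [hmap, smul_smul, ← ENNReal.ofReal_mul hdet.le, det_transpose, ← abs_mul,
      mul_inv_cancel₀ hB]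
    simp
  have hGint : Integrable G := by
    rw [hvol]
    refine Integrable.smul_measure ?_ ENNReal.ofReal_ne_top
    rw [hemb.integrable_map_iff]
    exact hFint.congr (Filter.Eventually.of_forall fun y => (hFG y).symm)
  have hGF : ∫ v, G v = |B.det| * ∫ y, F y := by
    conv_lhs => rw [hvol]
    rw [integral_smul_measure, hemb.integral_map, ENNReal.toReal_ofReal hdet.le, real_smul]
    congr 1
    exact integral_congr_ae (Filter.Eventually.of_forall fun y => hFG y)
  have hsplit := integral_eq_sum_unitCube hGint Z fun z hz u hu => by
    simp only [hG, hZ z hz u hu, mul_zero, ofReal_zero, zero_mul]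
  have hcube : ∫ u in unitCube d, character (fun j => (n j : ℝ)) (-u) * shiftedCubature B Z k u =
      ∫ u in unitCube d, ∑ z ∈ Z, G ((fun j => (z j : ℝ)) + u) := by
    refine integral_congr_ae (Filter.Eventually.of_forall fun u => ?_)
    simp only [shiftedCubature, Finset.mul_sum, hG]
    refine Finset.sum_congr rfl fun z _ => ?_
    have h1 : character (fun j => (n j : ℝ)) (-((fun j => (z j : ℝ)) + u)) =
        character (fun j => (n j : ℝ)) (-u) := by
      rw [← character_add_int n (-z) (-u)]
      congr 1
      funext j
      simp
      ring
    rw [h1]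
    ring
  rw [hcube, ← hsplit, hGF, hF, integral_const_mul, integral_multiWindow, ← mul_assoc,
    ← ofReal_mul, mul_inv_cancel₀ hdet.ne']
  simp

/-- Parseval in u. The coefficient n = 0 is the Fourier transform of the window at the integer point
k, which is exactly the integral of the monomial. The mean error vanishes, and only n ≠ 0
contributes. -/
theorem lintegral_shiftedCubature_error {d : ℕ} {B : Matrix (Fin d) (Fin d) ℝ} (hB : B.det ≠ 0)
    {Z : Finset (Fin d → ℤ)}
    (hZ : ∀ z ∉ Z, ∀ u ∈ unitCube d, multiWindow (Bᵀ⁻¹ *ᵥ ((fun j => (z j : ℝ)) + u)) = 0)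
    (k : Fin d → ℤ) :
    ∫⁻ u in unitCube d, ENNReal.ofReal (‖shiftedCubature B Z k u - if k = 0 then 1 else 0‖ ^ 2) =
      ∑' n : Fin d → ℤ, if n = 0 then 0 else ENNReal.ofReal
        (∏ j, ‖windowFourier (k j - (B *ᵥ fun i => (n i : ℝ)) j)‖ ^ 2) := by
  have hcont : Continuous fun u => shiftedCubature B Z k u - if k = 0 then (1 : ℂ) else 0 :=
    (continuous_shiftedCubature B Z k).sub continuous_const
  have hbox : unitCube d ⊆ Set.univ.pi fun _ => Set.Icc (0 : ℝ) 1 := fun x hx i _ => by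
    have := hx i
    simp only [Pi.zero_apply, zero_add] at this
    exact ⟨this.1.le, this.2⟩
  have hcomp : IsCompact (Set.univ.pi fun _ : Fin d => Set.Icc (0 : ℝ) 1) :=
    isCompact_univ_pi fun _ => isCompact_Icc
  have hmem : ∀ {f : (Fin d → ℝ) → ℂ}, Continuous f → ∀ q : ℝ≥0∞,
      MemLp f q (volume.restrict (unitCube d)) := fun {f} hf q => by
    obtain ⟨C, hC⟩ := hcomp.exists_bound_of_continuousOn hf.continuousOn
    refine MemLp.of_bound hf.aestronglyMeasurable C ?_
    refine (ae_restrict_iff' (measurableSet_unitCube d)).2 (Filter.Eventually.of_forall ?_)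
    exact fun x hx => hC x (hbox hx)
  rw [parseval_unitCube hcont.measurable (hmem hcont 2)]
  refine tsum_congr fun n => ?_
  have hchar : Continuous fun u : Fin d → ℝ => character (fun j => (n j : ℝ)) (-u) :=
    (continuous_character _).comp continuous_neg
  have hconst : ∫ u in unitCube d, character (fun j => (n j : ℝ)) (-u) = if n = 0 then 1 else 0 := by
    have h1 : unitCube d = Set.univ.pi fun _ => Set.Ioc (0 : ℝ) 1 := by
      ext x; simp [unitCube]
    simp only [character_eq_prod]
    rw [h1, volume_pi, Measure.restrict_pi_pi]
    simp only [Pi.neg_apply]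
    rw [integral_fintype_prod_eq_prod (μ := fun _ : Fin d => volume.restrict (Set.Ioc (0 : ℝ) 1))
      (f := fun j (x : ℝ) => exp (2 * Real.pi * I * (n j : ℝ) * ((-x : ℝ) : ℂ)))]
    have h2 : ∀ j, ∫ x in Set.Ioc (0 : ℝ) 1, exp (2 * Real.pi * I * (n j : ℝ) * ((-x : ℝ) : ℂ)) =
        if n j = 0 then 1 else 0 := fun j => by
      rw [← intervalIntegral.integral_of_le zero_le_one]
      have := integral_exp_int (-n j)
      simp only [neg_eq_zero] at this
      rw [← this]
      refine intervalIntegral.integral_congr fun x _ => ?_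
      congr 1
      push_cast
      ring
    simp only [h2]
    split_ifs with h
    · simp [h]
    · obtain ⟨j, hj⟩ := Function.ne_iff.1 h
      exact Finset.prod_eq_zero (Finset.mem_univ j) (if_neg hj)
  have hcoef : ∫ u in unitCube d, character (fun j => (n j : ℝ)) (-u) *
      (shiftedCubature B Z k u - if k = 0 then 1 else 0) =
      ∏ j, windowFourier (k j - (B *ᵥ fun i => (n i : ℝ)) j) -
        (if n = 0 then 1 else 0) * (if k = 0 then 1 else 0) := by
    simp only [mul_sub]
    rw [integral_sub, integral_shiftedCubature hB hZ, integral_mul_const, hconst]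
    · exact (hmem (hchar.mul (continuous_shiftedCubature B Z k)) 1).integrable le_rfl
    · exact (hmem (hchar.mul continuous_const) 1).integrable le_rfl
  rw [hcoef]
  split_ifs with hn hk hk
  · subst hn hk
    have : (fun i : Fin d => (((0 : Fin d → ℤ) i : ℤ) : ℝ)) = 0 := by ext; simp
    simp only [this, mulVec_zero]
    have h0 : windowFourier 0 = 1 := by simpa using windowFourier_int 0
    simp [h0]
  · subst hn
    have h1 : (fun i : Fin d => (((0 : Fin d → ℤ) i : ℤ) : ℝ)) = 0 := by ext; simp
    obtain ⟨j, hj⟩ := Function.ne_iff.1 hk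
    have h2 : windowFourier (k j) = 0 := by
      rw [windowFourier_int]
      exact if_neg hj
    have h3 : ∏ j, windowFourier (k j) = 0 := Finset.prod_eq_zero (Finset.mem_univ j) h2
    rw [h1, mulVec_zero]
    simp only [Pi.zero_apply, sub_zero]
    rw [h3]
    simp
  · simp [norm_prod, Finset.prod_pow]
  · simp [norm_prod, Finset.prod_pow]

end Parseval

/-! ### Fourier series of the functions in the class -/

section TorusFourier

/-- The monomial `x ↦ exp (i(k, x))` on the torus. -/
noncomputable def torusMonomial {d : ℕ} (k : Fin d → ℤ) (x : Torus d) : ℂ :=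
  ∏ j, fourier (k j) (x j)

theorem continuous_torusMonomial {d : ℕ} (k : Fin d → ℤ) : Continuous (torusMonomial k) := by
  unfold torusMonomial
  fun_prop

theorem torusMonomial_zero {d : ℕ} (x : Torus d) : torusMonomial 0 x = 1 := by
  simp [torusMonomial]

theorem torusMonomial_add {d : ℕ} (k l : Fin d → ℤ) (x : Torus d) :
    torusMonomial (k + l) x = torusMonomial k x * torusMonomial l x := by
  simp only [torusMonomial, Pi.add_apply, fourier_add, Finset.prod_mul_distrib]

theorem torusMonomial_neg {d : ℕ} (k : Fin d → ℤ) (x : Torus d) :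
    torusMonomial (-k) x = conj (torusMonomial k x) := by
  simp only [torusMonomial, Pi.neg_apply, fourier_neg, map_prod]

theorem torusMonomial_sub_index {d : ℕ} (k l : Fin d → ℤ) (x : Torus d) :
    torusMonomial (k - l) x = torusMonomial k x * conj (torusMonomial l x) := by
  rw [sub_eq_add_neg, torusMonomial_add, torusMonomial_neg]

theorem norm_torusMonomial {d : ℕ} (k : Fin d → ℤ) (x : Torus d) : ‖torusMonomial k x‖ = 1 := by
  simp only [torusMonomial, norm_prod, fourier_apply, Circle.norm_coe, Finset.prod_const_one]

theorem fourier_sub_arg (n : ℤ) (x y : AddCircle (2 * Real.pi)) :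
    (fourier n (x - y) : ℂ) = fourier n x * fourier (-n) y := by
  induction x using QuotientAddGroup.induction_on with
  | H s =>
    induction y using QuotientAddGroup.induction_on with
    | H t =>
      rw [← AddCircle.coe_sub, fourier_coe_apply, fourier_coe_apply, fourier_coe_apply,
        ← Complex.exp_add]
      congr 1
      push_cast
      ring

theorem torusMonomial_sub {d : ℕ} (k : Fin d → ℤ) (x y : Torus d) :
    torusMonomial k (x - y) = torusMonomial k x * torusMonomial (-k) y := by
  simp only [torusMonomial, Pi.sub_apply, Pi.neg_apply, fourier_sub_arg, Finset.prod_mul_distrib]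

theorem torusFourierCoeff_eq {d : ℕ} (f : Torus d → ℂ) (k : Fin d → ℤ) :
    torusFourierCoeff f k = ∫ x, torusMonomial (-k) x * f x ∂torusMeasure d := rfl

theorem integral_torusMonomial {d : ℕ} (k : Fin d → ℤ) :
    ∫ x, torusMonomial k x ∂torusMeasure d = if k = 0 then 1 else 0 := by
  simp only [torusMonomial, torusMeasure]
  rw [integral_fintype_prod_eq_prod
    (f := fun j (t : AddCircle (2 * Real.pi)) => (fourier (k j) t : ℂ))]
  have h : ∀ n : ℤ, ∫ t : AddCircle (2 * Real.pi), (fourier n t : ℂ) ∂AddCircle.haarAddCircle =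
      if n = 0 then 1 else 0 := fun n => by
    have h1 := (orthonormal_iff_ite.1 (orthonormal_fourier (T := 2 * Real.pi))) 0 n
    rw [ContinuousMap.inner_toLp] at h1
    simp only [fourier_zero, map_one, mul_one] at h1
    rw [h1]
    simp only [eq_comm]
  simp only [h]
  split_ifs with h0
  · simp [h0]
  · obtain ⟨j, hj⟩ := Function.ne_iff.1 h0
    exact Finset.prod_eq_zero (Finset.mem_univ j) (if_neg hj)

theorem memLp_torusMonomial {d : ℕ} (k : Fin d → ℤ) (q : ℝ≥0∞) :
    MemLp (torusMonomial k) q (torusMeasure d) :=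
  MemLp.of_bound (continuous_torusMonomial k).aestronglyMeasurable 1
    (Filter.Eventually.of_forall fun x => (norm_torusMonomial k x).le)

section

noncomputable local instance : MeasureSpace UnitAddCircle := ⟨AddCircle.haarAddCircle⟩

local instance : Measure.IsAddHaarMeasure (volume : Measure UnitAddCircle) :=
  inferInstanceAs (Measure.IsAddHaarMeasure AddCircle.haarAddCircle)

local instance : IsProbabilityMeasure (volume : Measure UnitAddCircle) :=
  inferInstanceAs (IsProbabilityMeasure AddCircle.haarAddCircle)

theorem measurePreserving_equivAddCircle :
    MeasurePreserving (AddCircle.equivAddCircle 1 (2 * Real.pi) one_ne_zero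
      Real.two_pi_pos.ne') (AddCircle.haarAddCircle) AddCircle.haarAddCircle := by
  have hc : Continuous (AddCircle.equivAddCircle (1 : ℝ) (2 * Real.pi) one_ne_zero
      Real.two_pi_pos.ne') :=
    (AddCircle.homeomorphAddCircle (1 : ℝ) (2 * Real.pi) one_ne_zero Real.two_pi_pos.ne').continuous
  exact AddMonoidHom.measurePreserving
    (f := (AddCircle.equivAddCircle (1 : ℝ) (2 * Real.pi) one_ne_zero
      Real.two_pi_pos.ne').toAddMonoidHom) hc (AddEquiv.surjective _) (by simp)

theorem fourier_equivAddCircle (n : ℤ) (x : UnitAddCircle) :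
    (fourier n (AddCircle.equivAddCircle 1 (2 * Real.pi) one_ne_zero Real.two_pi_pos.ne' x) : ℂ) =
      fourier n x := by
  induction x using QuotientAddGroup.induction_on with
  | H t =>
    rw [AddCircle.equivAddCircle_apply_mk, fourier_coe_apply, fourier_coe_apply]
    congr 1
    have : (Real.pi : ℂ) ≠ 0 := by simp [Real.pi_ne_zero]
    push_cast
    field_simp

/-- Parseval's identity on the torus of period `2π`. -/
theorem parseval_torus {d : ℕ} {f g : Torus d → ℂ} (hf : MemLp f 2 (torusMeasure d))
    (hg : MemLp g 2 (torusMeasure d)) :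
    HasSum (fun k => conj (torusFourierCoeff f k) * torusFourierCoeff g k)
      (∫ x, conj (f x) * g x ∂torusMeasure d) := by
  set e : UnitAddTorus (Fin d) → Torus d := fun t j =>
    AddCircle.equivAddCircle 1 (2 * Real.pi) one_ne_zero Real.two_pi_pos.ne' (t j) with he
  have hmp : MeasurePreserving e volume (torusMeasure d) :=
    measurePreserving_pi _ _ fun _ : Fin d => measurePreserving_equivAddCircle
  have hemb : MeasurableEmbedding e := by
    refine (Continuous.measurableEmbedding ?_ fun s t hst => ?_)
    · refine continuous_pi fun j => ?_
      exact (AddCircle.homeomorphAddCircle (1 : ℝ) (2 * Real.pi) one_ne_zero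
        Real.two_pi_pos.ne').continuous.comp (continuous_apply j)
    · funext j
      exact (AddEquiv.injective _) (congrFun hst j)
  have hf' := hf.comp_measurePreserving hmp
  have hg' := hg.comp_measurePreserving hmp
  have hP := UnitAddTorus.hasSum_prod_mFourierCoeff hf'.toLp hg'.toLp
  have hcoef : ∀ {h : Torus d → ℂ} (hh : MemLp (h ∘ e) 2 volume) (k : Fin d → ℤ),
      UnitAddTorus.mFourierCoeff hh.toLp k = torusFourierCoeff h k := fun {h} hh k => by
    have h1 : UnitAddTorus.mFourierCoeff hh.toLp k = UnitAddTorus.mFourierCoeff (h ∘ e) k :=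
      integral_congr_ae (by filter_upwards [hh.coeFn_toLp] with t ht; rw [ht])
    rw [h1, torusFourierCoeff_eq, ← hmp.integral_comp hemb]
    refine integral_congr_ae (Filter.Eventually.of_forall fun t => ?_)
    simp only [UnitAddTorus.mFourier, ContinuousMap.coe_mk, Function.comp_apply, smul_eq_mul,
      torusMonomial, he, fourier_equivAddCircle]
  simp only [hcoef] at hP
  convert hP using 1
  rw [← hmp.integral_comp hemb]
  refine integral_congr_ae ?_
  filter_upwards [hf'.coeFn_toLp, hg'.coeFn_toLp] with t h1 h2
  rw [h1, h2]
  rfl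

end

theorem hasSum_sq_torusFourierCoeff {d : ℕ} {f : Torus d → ℂ} (hf : MemLp f 2 (torusMeasure d)) :
    HasSum (fun k => ‖torusFourierCoeff f k‖ ^ 2) (∫ x, ‖f x‖ ^ 2 ∂torusMeasure d) := by
  have h := parseval_torus hf hf
  have h1 : ∀ z : ℂ, conj z * z = ((‖z‖ ^ 2 : ℝ) : ℂ) := fun z => by
    rw [Complex.conj_mul']
    push_cast
    rfl
  simp only [h1] at h
  rw [integral_complex_ofReal] at h
  exact Complex.hasSum_ofReal.1 h

theorem measurePreserving_sub_left_torus {d : ℕ} (x : Torus d) :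
    MeasurePreserving (fun y => x - y) (torusMeasure d) (torusMeasure d) := by
  unfold torusMeasure
  have h : ∀ j, MeasurePreserving (fun y : AddCircle (2 * Real.pi) => x j - y)
      AddCircle.haarAddCircle AddCircle.haarAddCircle := fun j => by
    have := Measure.IsAddHaarMeasure.isNegInvariant_of_regular
      (μ := (AddCircle.haarAddCircle : Measure (AddCircle (2 * Real.pi))))
    exact Measure.measurePreserving_sub_left _ (x j)
  exact measurePreserving_pi _ _ h

theorem measurableEmbedding_sub_left_torus {d : ℕ} (x : Torus d) :
    MeasurableEmbedding (fun y : Torus d => x - y) :=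
  (MeasurableEquiv.subLeft x).measurableEmbedding

variable {d : ℕ} {r : ℝ} (hr : 1 / 2 < r)

theorem memLp_mixedKernel : MemLp (mixedKernel d hr) 2 (torusMeasure d) := by
  rw [memLp_two_iff_integrable_sq_norm (integrable_mixedKernel d hr).aestronglyMeasurable]
  simp only [mixedKernel, norm_prod, ← Finset.prod_pow]
  refine Integrable.fintype_prod (f := fun _ (t : AddCircle (2 * Real.pi)) =>
    ‖univariateKernel hr t‖ ^ 2) fun _ => ?_
  exact (memLp_two_iff_integrable_sq_norm (Lp.memLp _).aestronglyMeasurable).1 (Lp.memLp _)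

theorem torusFourierCoeff_mixedKernel' (k : Fin d → ℤ) :
    torusFourierCoeff (mixedKernel d hr) k = (mixedWeight r k : ℂ) :=
  torusFourierCoeff_mixedKernel d hr k

theorem integral_mixedKernel_mul_torusMonomial (k : Fin d → ℤ) (x : Torus d) :
    ∫ y, mixedKernel d hr (x - y) * torusMonomial k y ∂torusMeasure d =
      mixedWeight r k * torusMonomial k x := by
  rw [← torusFourierCoeff_mixedKernel' hr, torusFourierCoeff_eq,
    ← (measurePreserving_sub_left_torus x).integral_comp (measurableEmbedding_sub_left_torus x),
    ← integral_mul_const]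
  refine integral_congr_ae (Filter.Eventually.of_forall fun y => ?_)
  simp only
  rw [torusMonomial_sub, sub_sub_cancel]
  ring

/-- At fixed x the value f(x) is an inner product of φ with a translate of the kernel, so Parseval
gives the series at every point. Almost everywhere would not do for sampling. -/
theorem hasSum_mixedClass {f : Torus d → ℂ} (hf : f ∈ mixedClass d hr) :
    ∃ b : (Fin d → ℤ) → ℂ, Summable (fun k => ‖b k‖ ^ 2) ∧ ∑' k, ‖b k‖ ^ 2 ≤ 1 ∧
      ∀ x, HasSum (fun k => mixedWeight r k * b k * torusMonomial k x) (f x) := by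
  obtain ⟨φ, hφ, hφ1, hfφ⟩ := hf
  have hP := hasSum_sq_torusFourierCoeff hφ
  refine ⟨torusFourierCoeff φ, hP.summable, ?_, fun x => ?_⟩
  · rw [hP.tsum_eq]
    have h1 := hφ.eLpNorm_eq_integral_rpow_norm two_ne_zero ENNReal.ofNat_ne_top
    rw [h1, ENNReal.ofReal_le_one] at hφ1
    simp only [ENNReal.toReal_ofNat, Real.rpow_ofNat] at hφ1
    by_contra! h2
    have := Real.one_lt_rpow h2 (show (0 : ℝ) < 2⁻¹ by norm_num)
    linarith
  · have hK : MemLp (fun y => conj (mixedKernel d hr (x - y))) 2 (torusMeasure d) :=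
      ((memLp_mixedKernel hr).comp_measurePreserving (measurePreserving_sub_left_torus x)).star
    have h := parseval_torus hK hφ
    simp only [Complex.conj_conj] at h
    rw [← hfφ x] at h
    refine h.congr_fun fun k => ?_
    have h1 : torusFourierCoeff (fun y => conj (mixedKernel d hr (x - y))) k =
        conj (mixedWeight r k * torusMonomial k x) := by
      rw [← integral_mixedKernel_mul_torusMonomial hr k x, torusFourierCoeff_eq, ← integral_conj]
      refine integral_congr_ae (Filter.Eventually.of_forall fun y => ?_)
      simp only
      rw [torusMonomial_neg, map_mul, mul_comm]
    rw [h1, Complex.conj_conj]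
    ring

theorem torusFourierCoeff_sum (s : Finset (Fin d → ℤ)) (a : (Fin d → ℤ) → ℂ) (l : Fin d → ℤ) :
    torusFourierCoeff (fun x => ∑ k ∈ s, a k * torusMonomial k x) l =
      if l ∈ s then a l else 0 := by
  have h1 : ∀ x, torusMonomial (-l) x * ∑ k ∈ s, a k * torusMonomial k x =
      ∑ k ∈ s, a k * torusMonomial (k - l) x := fun x => by
    rw [Finset.mul_sum]
    refine Finset.sum_congr rfl fun k _ => ?_
    rw [torusMonomial_sub_index, torusMonomial_neg]
    ring
  rw [torusFourierCoeff_eq]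
  simp only [h1]
  rw [integral_finsetSum _ fun k _ => ((memLp_torusMonomial _ 1).integrable le_rfl).const_mul _]
  simp only [integral_const_mul, integral_torusMonomial, sub_eq_zero]
  simp

theorem memLp_sum_torusMonomial (s : Finset (Fin d → ℤ)) (a : (Fin d → ℤ) → ℂ) (q : ℝ≥0∞) :
    MemLp (fun x => ∑ k ∈ s, a k * torusMonomial k x) q (torusMeasure d) :=
  memLp_finsetSum _ fun k _ => (memLp_torusMonomial k q).const_mul _

theorem integral_sq_sum_torusMonomial (s : Finset (Fin d → ℤ)) (a : (Fin d → ℤ) → ℂ) :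
    ∫ x, ‖∑ k ∈ s, a k * torusMonomial k x‖ ^ 2 ∂torusMeasure d = ∑ k ∈ s, ‖a k‖ ^ 2 := by
  have hP := hasSum_sq_torusFourierCoeff (memLp_sum_torusMonomial s a 2)
  simp only [torusFourierCoeff_sum] at hP
  rw [hP.unique (hasSum_sum_of_ne_finset_zero (s := s) fun l hl => by simp [hl])]
  exact Finset.sum_congr rfl fun k hk => by rw [if_pos hk]

theorem sum_mem_mixedClass (s : Finset (Fin d → ℤ)) (a : (Fin d → ℤ) → ℂ)
    (ha : ∑ k ∈ s, mixedWeight (-(2 * r)) k * ‖a k‖ ^ 2 ≤ 1) :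
    (fun x => ∑ k ∈ s, a k * torusMonomial k x) ∈ mixedClass d hr := by
  -- Multiplying the coefficients by ∏ (k_j^*)^r undoes the convolution with the kernel.
  set φ : Torus d → ℂ := fun x => ∑ k ∈ s, mixedWeight (-r) k * a k * torusMonomial k x with hφ
  have hmem : MemLp φ 2 (torusMeasure d) := memLp_sum_torusMonomial s _ 2
  refine ⟨φ, hmem, ?_, fun x => ?_⟩
  · rw [hmem.eLpNorm_eq_integral_rpow_norm two_ne_zero ENNReal.ofNat_ne_top,
      ENNReal.ofReal_le_one]
    simp only [ENNReal.toReal_ofNat, Real.rpow_ofNat]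
    rw [hφ, integral_sq_sum_torusMonomial]
    refine Real.rpow_le_one (Finset.sum_nonneg fun _ _ => by positivity) ?_ (by norm_num)
    refine le_trans (le_of_eq ?_) ha
    refine Finset.sum_congr rfl fun l _ => ?_
    rw [norm_mul, mul_pow, Complex.norm_real, Real.norm_of_nonneg (mixedWeight_pos _ _).le, sq,
      mixedWeight_mul]
    congr 2
    ring
  · have hint : ∀ k ∈ s, Integrable (fun y => mixedWeight (-r) k * a k *
        (mixedKernel d hr (x - y) * torusMonomial k y)) (torusMeasure d) := fun k _ => by
      refine Integrable.const_mul ?_ _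
      exact ((memLp_mixedKernel hr).comp_measurePreserving
        (measurePreserving_sub_left_torus x)).integrable_mul (memLp_torusMonomial k 2)
    have h1 : ∀ y, mixedKernel d hr (x - y) * φ y = ∑ k ∈ s, mixedWeight (-r) k * a k *
        (mixedKernel d hr (x - y) * torusMonomial k y) := fun y => by
      rw [hφ, Finset.mul_sum]
      exact Finset.sum_congr rfl fun k _ => by ring
    simp only [h1]
    rw [integral_finsetSum _ hint]
    refine Finset.sum_congr rfl fun k _ => ?_
    rw [integral_const_mul, integral_mixedKernel_mul_torusMonomial]
    have h2 : (mixedWeight (-r) k : ℂ) * mixedWeight r k = 1 := by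
      rw [← Complex.ofReal_mul, mixedWeight_mul, neg_add_cancel]
      simp [mixedWeight]
    linear_combination (-(a k * torusMonomial k x)) * h2

end TorusFourier

/-! ### The upper bound -/

section UpperBound

theorem tsum_mixedWeight_ne_top {p : ℝ} (hp : 1 < p) (d : ℕ) :
    ∑' k : Fin d → ℤ, ENNReal.ofReal (mixedWeight p k) ≠ ∞ := by
  have hpos : ∀ k : ℤ, 0 ≤ starAbs k ^ (-p) := fun k => Real.rpow_nonneg (starAbs_pos k).le _
  have h : ∀ k : Fin d → ℤ, ENNReal.ofReal (mixedWeight p k) =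
      ∏ j, ENNReal.ofReal (starAbs (k j) ^ (-p)) := fun k =>
    ENNReal.ofReal_prod_of_nonneg fun j _ => hpos _
  simp_rw [h]
  refine ne_top_of_le_ne_top ?_ (tsum_prod_le_prod_tsum fun (_ : Fin d) (k : ℤ) =>
    ENNReal.ofReal (starAbs k ^ (-p)))
  refine ENNReal.prod_ne_top fun j _ => ?_
  rw [← ENNReal.ofReal_tsum_of_nonneg hpos (summable_starAbs hp)]
  exact ENNReal.ofReal_ne_top

theorem summable_mixedWeight {p : ℝ} (hp : 1 < p) (d : ℕ) :
    Summable fun k : Fin d → ℤ => mixedWeight p k := by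
  refine (ENNReal.summable_toReal (tsum_mixedWeight_ne_top hp d)).congr fun k => ?_
  exact ENNReal.toReal_ofReal (mixedWeight_pos p k).le

/-- The error of a weighted point sum as a functional on monomials controls its error as a
discretization of the `L_2` norm on the class. -/
theorem abs_integral_sub_sum_le {d : ℕ} {r : ℝ} (hr : 1 / 2 < r) {m : ℕ} (ξ : Fin m → Torus d)
    (w : Fin m → ℝ) {ε : ℝ} (hε : 0 ≤ ε)
    (hE : ∑' q : (Fin d → ℤ) × (Fin d → ℤ), ENNReal.ofReal (mixedWeight (2 * r) q.1 *
      mixedWeight (2 * r) q.2 * ‖∑ j, (w j : ℂ) * torusMonomial (q.1 - q.2) (ξ j) -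
        if q.1 - q.2 = 0 then 1 else 0‖ ^ 2) ≤ ENNReal.ofReal (ε ^ 2))
    {f : Torus d → ℂ} (hf : f ∈ mixedClass d hr) :
    |∫ x, ‖f x‖ ^ (2 : ℝ) ∂torusMeasure d - ∑ j, w j * ‖f (ξ j)‖ ^ (2 : ℝ)| ≤ ε := by
  obtain ⟨b, hb, hb1, hfb⟩ := hasSum_mixedClass hr hf
  set c : (Fin d → ℤ) → ℂ := fun k => mixedWeight r k * b k with hc
  have hcn : ∀ k, ‖c k‖ = mixedWeight r k * ‖b k‖ := fun k => by
    rw [hc, norm_mul, Complex.norm_real, Real.norm_of_nonneg (mixedWeight_pos _ _).le]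
  have hcs : Summable fun k => ‖c k‖ := by
    -- A product is at most the sum of the squares, and the squared weights are summable because 2r
    -- > 1.
    refine Summable.of_nonneg_of_le (fun _ => norm_nonneg _) (fun k => ?_)
      ((summable_mixedWeight (p := 2 * r) (by linarith) d).add hb)
    have h1 : mixedWeight (2 * r) k = mixedWeight r k ^ 2 := by
      rw [sq, mixedWeight_mul, two_mul]
    rw [hcn, h1]
    nlinarith [sq_nonneg (mixedWeight r k - ‖b k‖), sq_nonneg (mixedWeight r k),
      sq_nonneg ‖b k‖]
  have hfc : ∀ x, HasSum (fun k => c k * torusMonomial k x) (f x) := hfb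
  clear_value c
  set D : (Fin d → ℤ) × (Fin d → ℤ) → ℂ := fun q => c q.1 * conj (c q.2) with hD
  have hDn : ∀ q, ‖D q‖ = ‖c q.1‖ * ‖c q.2‖ := fun q => by
    rw [hD, norm_mul, RCLike.norm_conj]
  have hDs : Summable fun q => ‖D q‖ := by
    simp only [hDn]
    exact hcs.mul_of_nonneg hcs (fun _ => norm_nonneg _) fun _ => norm_nonneg _
  have hpt : ∀ x, HasSum (fun q => D q * torusMonomial (q.1 - q.2) x)
      ((‖f x‖ ^ (2 : ℝ) : ℝ) : ℂ) := fun x => by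
    have h1 := hfc x
    have h2 : HasSum (fun k => conj (c k * torusMonomial k x)) (conj (f x)) :=
      (Complex.hasSum_conj').2 (by simpa using h1)
    have h3 := h1.mul h2 (by
      refine Summable.of_norm ?_
      refine hDs.congr fun q => ?_
      rw [hDn, norm_mul, RCLike.norm_conj, norm_mul, norm_mul, norm_torusMonomial,
        norm_torusMonomial, mul_one, mul_one])
    have h4 : f x * conj (f x) = ((‖f x‖ ^ (2 : ℝ) : ℝ) : ℂ) := by
      rw [Complex.mul_conj', Real.rpow_two]
      push_cast
      rfl
    rw [h4] at h3
    refine h3.congr_fun fun q => ?_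
    rw [torusMonomial_sub_index, hD, map_mul]
    ring
  have hsum : HasSum (fun q => D q * ∑ j, (w j : ℂ) * torusMonomial (q.1 - q.2) (ξ j))
      ((∑ j, w j * ‖f (ξ j)‖ ^ (2 : ℝ) : ℝ) : ℂ) := by
    have h1 := hasSum_sum (s := Finset.univ) fun j _ => (hpt (ξ j)).mul_left (w j : ℂ)
    push_cast at h1 ⊢
    refine h1.congr_fun fun q => ?_
    rw [Finset.mul_sum]
    exact Finset.sum_congr rfl fun j _ => by ring
  have hint : HasSum (fun q => D q * if q.1 - q.2 = 0 then 1 else 0)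
      ((∫ x, ‖f x‖ ^ (2 : ℝ) ∂torusMeasure d : ℝ) : ℂ) := by
    have h1 := hasSum_integral_of_summable_integral_norm (μ := torusMeasure d)
      (F := fun q x => D q * torusMonomial (q.1 - q.2) x)
      (fun q => ((memLp_torusMonomial _ 1).integrable le_rfl).const_mul _) (by
        refine hDs.congr fun q => ?_
        simp [norm_torusMonomial])
    simp only [(hpt _).tsum_eq, integral_const_mul, integral_torusMonomial] at h1
    rwa [integral_complex_ofReal] at h1
  have hdiff := hint.sub hsum
  simp only [← mul_sub] at hdiff
  rw [← Complex.ofReal_sub] at hdiff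
  set E : (Fin d → ℤ) × (Fin d → ℤ) → ℂ := fun q =>
    (if q.1 - q.2 = 0 then 1 else 0) - ∑ j, (w j : ℂ) * torusMonomial (q.1 - q.2) (ξ j) with hEdef
  have hbb := hb.mul_of_nonneg hb (fun _ => by positivity) fun _ => by positivity
  have hbb1 : ∑' q : (Fin d → ℤ) × (Fin d → ℤ), ‖b q.1‖ ^ 2 * ‖b q.2‖ ^ 2 ≤ 1 := by
    rw [← hb.tsum_mul_tsum hb hbb]
    exact mul_le_one₀ hb1 (tsum_nonneg fun _ => by positivity) hb1
  -- Cauchy–Schwarz on pairs: the factors |b_k b_l| have square sum at most 1, and the weights go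
  -- with the cubature error. The bound is uniform in the finite set and passes to the limit.
  have hfin : ∀ s : Finset ((Fin d → ℤ) × (Fin d → ℤ)), ‖∑ q ∈ s, D q * E q‖ ≤ ε := fun s => by
    have h1 : ∑ q ∈ s, (‖b q.1‖ * ‖b q.2‖) ^ 2 ≤ 1 := by
      refine le_trans ?_ hbb1
      simp only [mul_pow]
      exact hbb.sum_le_tsum s fun _ _ => by positivity
    have h2 : ∑ q ∈ s, (mixedWeight r q.1 * mixedWeight r q.2 * ‖E q‖) ^ 2 ≤ ε ^ 2 := by
      rw [← ENNReal.ofReal_le_ofReal_iff (by positivity)]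
      refine le_trans ?_ hE
      rw [ENNReal.ofReal_sum_of_nonneg fun _ _ => by positivity]
      refine le_trans (Finset.sum_le_sum fun q _ => ?_) (ENNReal.sum_le_tsum s)
      refine ENNReal.ofReal_le_ofReal (le_of_eq ?_)
      rw [hEdef, norm_sub_rev, two_mul, ← mixedWeight_mul, ← mixedWeight_mul]
      ring
    have h3 : ‖∑ q ∈ s, D q * E q‖ ≤
        ∑ q ∈ s, (‖b q.1‖ * ‖b q.2‖) * (mixedWeight r q.1 * mixedWeight r q.2 * ‖E q‖) := by
      refine (norm_sum_le _ _).trans (Finset.sum_le_sum fun q _ => le_of_eq ?_)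
      rw [norm_mul, hDn, hcn, hcn]
      ring
    refine h3.trans (abs_le_of_sq_le_sq' ?_ hε).2
    refine (Finset.sum_mul_sq_le_sq_mul_sq _ _ _).trans ?_
    calc _ ≤ 1 * ε ^ 2 := mul_le_mul h1 h2 (Finset.sum_nonneg fun _ _ => by positivity) zero_le_one
      _ = ε ^ 2 := one_mul _
  have hlim := le_of_tendsto hdiff.norm (Filter.Eventually.of_forall hfin)
  rwa [Complex.norm_real, Real.norm_eq_abs] at hlim

theorem optimalError_le_of_tsum_le {d : ℕ} {r : ℝ} (hr : 1 / 2 < r) {m : ℕ} (ξ : Fin m → Torus d)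
    (w : Fin m → ℝ) {ε : ℝ} (hε : 0 ≤ ε)
    (hE : ∑' q : (Fin d → ℤ) × (Fin d → ℤ), ENNReal.ofReal (mixedWeight (2 * r) q.1 *
      mixedWeight (2 * r) q.2 * ‖∑ j, (w j : ℂ) * torusMonomial (q.1 - q.2) (ξ j) -
        if q.1 - q.2 = 0 then 1 else 0‖ ^ 2) ≤ ENNReal.ofReal (ε ^ 2)) :
    optimalError (torusMeasure d) (mixedClass d hr) 2 m ≤ ENNReal.ofReal ε := by
  refine iInf₂_le_of_le ξ w (iSup₂_le fun f hf => ENNReal.ofReal_le_ofReal ?_)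
  exact abs_integral_sub_sum_le hr ξ w hε hE hf

/-- Zero weights already give a bounded error; this handles the finitely many small m. -/
theorem exists_optimalError_le_const (d : ℕ) {r : ℝ} (hr : 1 / 2 < r) :
    ∃ K : ℝ, 0 < K ∧ ∀ m : ℕ,
      optimalError (torusMeasure d) (mixedClass d hr) 2 m ≤ ENNReal.ofReal K := by
  have hp : 1 < 2 * r := by linarith
  have hs := summable_mixedWeight hp d
  have hpos : ∀ k : Fin d → ℤ, 0 ≤ mixedWeight (2 * r) k := fun k => (mixedWeight_pos _ k).le
  refine ⟨∑' k : Fin d → ℤ, mixedWeight (2 * r) k, hs.tsum_pos hpos 0 (mixedWeight_pos _ _),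
    fun m => ?_⟩
  refine optimalError_le_of_tsum_le hr (fun _ => 0) (fun _ => 0) (tsum_nonneg hpos) ?_
  have hss := hs.mul_of_nonneg hs hpos hpos
  rw [sq, hs.tsum_mul_tsum hs hss, ENNReal.ofReal_tsum_of_nonneg
    (fun q => mul_nonneg (hpos _) (hpos _)) hss]
  refine ENNReal.tsum_le_tsum fun q => ENNReal.ofReal_le_ofReal ?_
  refine mul_le_of_le_one_right (mul_nonneg (hpos _) (hpos _)) ?_
  split_ifs <;> simp

/-- Surplus nodes receive weight zero. -/
theorem exists_fin_reindex {κ Ω : Type*} [Inhabited Ω] (Z : Finset κ) {m : ℕ} (hm : Z.card ≤ m)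
    (node : κ → Ω) (wt : κ → ℝ) :
    ∃ (ξ : Fin m → Ω) (w : Fin m → ℝ), ∀ g : Ω → ℂ,
      ∑ j, (w j : ℂ) * g (ξ j) = ∑ z ∈ Z, (wt z : ℂ) * g (node z) := by
  obtain ⟨f⟩ := Function.Embedding.nonempty_of_card_le (α := Z) (β := Fin m) (by simpa using hm)
  refine ⟨Function.extend f (fun z => node z) default, Function.extend f (fun z => wt z) 0,
    fun g => ?_⟩
  rw [← Finset.sum_coe_sort Z]
  symm
  refine Fintype.sum_of_injective f f.injective _ _ (fun i hi => ?_) fun z => ?_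
  · rw [Function.extend_apply' _ _ _ fun ⟨z, hz⟩ => hi ⟨z, hz⟩]
    simp
  · rw [f.injective.extend_apply, f.injective.extend_apply]

/-- The point of the torus with coordinates `2π y_j`. -/
noncomputable def torusPoint {d : ℕ} (y : Fin d → ℝ) : Torus d :=
  fun j => ((2 * Real.pi * y j : ℝ) : AddCircle (2 * Real.pi))

theorem torusMonomial_torusPoint {d : ℕ} (k : Fin d → ℤ) (y : Fin d → ℝ) :
    torusMonomial k (torusPoint y) = character (fun j => (k j : ℝ)) y := by
  rw [character_eq_prod, torusMonomial]
  refine Finset.prod_congr rfl fun j _ => ?_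
  rw [torusPoint, fourier_coe_apply]
  congr 1
  have : (Real.pi : ℂ) ≠ 0 := by simp [Real.pi_ne_zero]
  push_cast
  field_simp

open Matrix in
/-- The mean square over the shifts of the error of the shifted lattice cubature. -/
theorem lintegral_tsum_error_le (d : ℕ) {p : ℝ} (hp : 1 < p) :
    ∃ C : ℝ, 0 < C ∧ ∀ (B : Matrix (Fin d) (Fin d) ℝ) (_ : B.det ≠ 0) (Z : Finset (Fin d → ℤ)),
      (∀ z ∉ Z, ∀ u ∈ unitCube d, multiWindow (Bᵀ⁻¹ *ᵥ ((fun j => (z j : ℝ)) + u)) = 0) →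
      ∫⁻ u in unitCube d, ∑' q : (Fin d → ℤ) × (Fin d → ℤ), ENNReal.ofReal (mixedWeight p q.1 *
        mixedWeight p q.2 *
          ‖shiftedCubature B Z (q.1 - q.2) u - if q.1 - q.2 = 0 then 1 else 0‖ ^ 2) ≤
      ENNReal.ofReal C * ∑' n : Fin d → ℤ, if n = 0 then 0 else
        ENNReal.ofReal (∏ j, (1 + |(B *ᵥ fun i => (n i : ℝ)) j|) ^ (-p)) := by
  obtain ⟨C₁, hC₁, h₁⟩ := tsum_mixedWeight_add_le hp d
  obtain ⟨C₂, hC₂, h₂⟩ := tsum_mixedWeight_conv_le hp d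
  obtain ⟨C₃, hC₃, h₃⟩ := windowFourier_decay p
  refine ⟨C₁ * (C₃ ^ d * C₂), by positivity, fun B hB Z hZ => ?_⟩
  have hmw : ∀ k : Fin d → ℤ, 0 ≤ mixedWeight p k := fun k => (mixedWeight_pos p k).le
  have hmeas : ∀ q : (Fin d → ℤ) × (Fin d → ℤ), Measurable fun u => ENNReal.ofReal
      (mixedWeight p q.1 * mixedWeight p q.2 *
        ‖shiftedCubature B Z (q.1 - q.2) u - if q.1 - q.2 = 0 then 1 else 0‖ ^ 2) := fun q => by
    have := (continuous_shiftedCubature B Z (q.1 - q.2)).measurable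
    fun_prop
  set err : (Fin d → ℤ) → ℝ≥0∞ := fun k => ∫⁻ u in unitCube d,
    ENNReal.ofReal (‖shiftedCubature B Z k u - if k = 0 then 1 else 0‖ ^ 2) with herr
  rw [lintegral_tsum fun q => (hmeas q).aemeasurable]
  have hpull : ∀ q : (Fin d → ℤ) × (Fin d → ℤ), ∫⁻ u in unitCube d, ENNReal.ofReal
      (mixedWeight p q.1 * mixedWeight p q.2 *
        ‖shiftedCubature B Z (q.1 - q.2) u - if q.1 - q.2 = 0 then 1 else 0‖ ^ 2) =
      ENNReal.ofReal (mixedWeight p q.1 * mixedWeight p q.2) * err (q.1 - q.2) := fun q => by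
    simp only [herr]
    rw [← lintegral_const_mul' _ _ ENNReal.ofReal_ne_top]
    simp only [← ENNReal.ofReal_mul (mul_nonneg (hmw q.1) (hmw q.2))]
  simp_rw [hpull]
  -- In the coordinates (k + l, l) the error depends on k alone, and the sum over l is the
  -- autocorrelation of the weight.
  let σ : (Fin d → ℤ) × (Fin d → ℤ) ≃ (Fin d → ℤ) × (Fin d → ℤ) :=
    { toFun := fun q => (q.1 + q.2, q.2)
      invFun := fun q => (q.1 - q.2, q.2)
      left_inv := fun q => by simp
      right_inv := fun q => by simp }
  rw [← σ.tsum_eq, ENNReal.tsum_prod']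
  simp only [σ, Equiv.coe_fn_mk, add_sub_cancel_right, ENNReal.tsum_mul_right]
  have herrk : ∀ k, err k ≤ ∑' n : Fin d → ℤ, if n = 0 then 0 else ENNReal.ofReal (C₃ ^ d *
      ∏ j, (1 + |(B *ᵥ fun i => (n i : ℝ)) j - k j|) ^ (-p)) := fun k => by
    rw [herr]
    simp only [lintegral_shiftedCubature_error hB hZ k]
    refine ENNReal.tsum_le_tsum fun n => ?_
    split_ifs with hn
    · exact le_rfl
    · refine ENNReal.ofReal_le_ofReal ?_
      have : C₃ ^ d = ∏ _j : Fin d, C₃ := by simp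
      rw [this, ← Finset.prod_mul_distrib]
      refine Finset.prod_le_prod (fun _ _ => by positivity) fun j _ => ?_
      rw [abs_sub_comm]
      exact h₃ _
  calc ∑' k, (∑' l, ENNReal.ofReal (mixedWeight p (k + l) * mixedWeight p l)) * err k
      ≤ ∑' k, ENNReal.ofReal (C₁ * mixedWeight p k) *
          ∑' n : Fin d → ℤ, if n = 0 then 0 else ENNReal.ofReal (C₃ ^ d *
            ∏ j, (1 + |(B *ᵥ fun i => (n i : ℝ)) j - k j|) ^ (-p)) := by
        refine ENNReal.tsum_le_tsum fun k => mul_le_mul' ?_ (herrk k)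
        refine le_trans (le_of_eq ?_) (h₁ k)
        exact tsum_congr fun l => by rw [mul_comm]
    _ = ∑' n : Fin d → ℤ, if n = 0 then 0 else ENNReal.ofReal (C₁ * C₃ ^ d) *
          ∑' k : Fin d → ℤ, ENNReal.ofReal (mixedWeight p k *
            ∏ j, (1 + |(B *ᵥ fun i => (n i : ℝ)) j - k j|) ^ (-p)) := by
        simp only [← ENNReal.tsum_mul_left]
        -- After the exchange the sum over k is a convolution evaluated at Bn.
        rw [ENNReal.tsum_comm]
        refine tsum_congr fun n => ?_
        split_ifs with hn
        · simp
        · refine tsum_congr fun k => ?_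
          rw [← ENNReal.ofReal_mul (mul_nonneg hC₁.le (hmw k)),
            ← ENNReal.ofReal_mul (by positivity)]
          congr 1
          ring
    _ ≤ ∑' n : Fin d → ℤ, if n = 0 then 0 else ENNReal.ofReal (C₁ * C₃ ^ d) *
          ENNReal.ofReal (C₂ * ∏ j, (1 + |(B *ᵥ fun i => (n i : ℝ)) j|) ^ (-p)) := by
        refine ENNReal.tsum_le_tsum fun n => ?_
        split_ifs with hn
        · exact le_rfl
        · exact mul_le_mul_right (h₂ _) _
    _ = _ := by
        rw [← ENNReal.tsum_mul_left]
        refine tsum_congr fun n => ?_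
        split_ifs with hn
        · simp
        · rw [← ENNReal.ofReal_mul (by positivity), ← ENNReal.ofReal_mul (by positivity)]
          congr 1
          ring

open Matrix in
-- A node y in the support satisfies |y_j| ≤ 1 and z + u = Bᵀy, so |z_i| is at most b plus 1 for the
-- shift. This bounds the number of nodes.
theorem multiWindow_eq_zero_of_notMem {d : ℕ} {B : Matrix (Fin d) (Fin d) ℝ} (hB : B.det ≠ 0)
    {b : ℕ} (hb : ∑ i, ∑ j, |B i j| ≤ b) {z : Fin d → ℤ}
    (hz : z ∉ Fintype.piFinset fun _ : Fin d => Finset.Icc (-((b : ℤ) + 1)) (b + 1))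
    {u : Fin d → ℝ} (hu : u ∈ unitCube d) :
    multiWindow (Bᵀ⁻¹ *ᵥ ((fun j => (z j : ℝ)) + u)) = 0 := by
  by_contra hne
  refine hz (Fintype.mem_piFinset.2 fun i => ?_)
  have hunit : IsUnit Bᵀ.det := isUnit_iff_ne_zero.2 (by rwa [det_transpose])
  set y := Bᵀ⁻¹ *ᵥ ((fun j => (z j : ℝ)) + u) with hy
  have hy1 : ∀ j, |y j| ≤ 1 := fun j =>
    (not_le.1 fun h => hne (multiWindow_eq_zero (j := j) h)).le
  have hzu : (z i : ℝ) + u i = ∑ j, B j i * y j := by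
    have : Bᵀ *ᵥ y = (fun j => (z j : ℝ)) + u := by
      rw [hy, mulVec_mulVec, mul_nonsing_inv _ hunit, one_mulVec]
    have h2 := congrFun this i
    simp only [mulVec, dotProduct, transpose_apply, Pi.add_apply] at h2
    exact h2.symm
  have hbound : |∑ j, B j i * y j| ≤ b := by
    refine le_trans (Finset.abs_sum_le_sum_abs _ _) (le_trans (Finset.sum_le_sum fun j _ => ?_) hb)
    rw [abs_mul]
    calc |B j i| * |y j| ≤ |B j i| * 1 := mul_le_mul_of_nonneg_left (hy1 j) (abs_nonneg _)
      _ ≤ ∑ i, |B j i| := by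
        rw [mul_one]
        exact Finset.single_le_sum (f := fun i => |B j i|) (fun _ _ => abs_nonneg _)
          (Finset.mem_univ i)
  have hui := hu i
  simp only [Pi.zero_apply, zero_add] at hui
  rw [← hzu, abs_le] at hbound
  rw [Finset.mem_Icc]
  constructor
  · have h1 : (-((b : ℤ) + 1) : ℝ) ≤ z i := by
      push_cast
      linarith [hbound.1, hui.2]
    exact_mod_cast h1
  · have h1 : (z i : ℝ) ≤ ((b : ℤ) + 1 : ℝ) := by
      push_cast
      linarith [hbound.2, hui.1]
    exact_mod_cast h1

open Matrix in
theorem exists_optimalError_le_lattice (e : ℕ) {r : ℝ} (hr : 1 / 2 < r) :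
    ∃ C : ℝ, ∃ β : ℕ, 0 < C ∧ 0 < β ∧ ∀ a m : ℕ, 1 ≤ a → (a * β) ^ (e + 1) ≤ m →
      optimalError (torusMeasure (e + 1)) (mixedClass (e + 1) hr) 2 m ≤
        ENNReal.ofReal √(C * (((a : ℝ) ^ (e + 1)) ^ (-(2 * r)) *
          (1 + Real.log ((a : ℝ) ^ (e + 1))) ^ e)) := by
  have hp : 1 < 2 * r := by linarith
  obtain ⟨L, hL, hadm⟩ := exists_admissible_forms (Nat.le_add_left 1 e)
  obtain ⟨C₁, hC₁, h₁⟩ := lintegral_tsum_error_le (e + 1) hp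
  obtain ⟨C₂, hC₂, h₂⟩ := sum_admissible_le hp e
  obtain ⟨β, hβ⟩ := exists_nat_ge (∑ i, ∑ j, |L i j|)
  -- Each coordinate of z takes 2aβ + 3 values, at most a(2β + 3) as a ≥ 1.
  refine ⟨C₁ * C₂, 2 * β + 3, by positivity, by positivity, fun a m ha ham => ?_⟩
  have ha' : (1 : ℝ) ≤ a := by exact_mod_cast ha
  have ha0 : (0 : ℝ) < a := by linarith
  set B : Matrix (Fin (e + 1)) (Fin (e + 1)) ℝ := (a : ℝ) • L with hBdef
  have hB : B.det ≠ 0 := by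
    rw [hBdef, det_smul]
    exact mul_ne_zero (pow_ne_zero _ ha0.ne') hL
  have hBsum : ∑ i, ∑ j, |B i j| ≤ (a * β : ℕ) := by
    simp only [hBdef, Matrix.smul_apply, smul_eq_mul, abs_mul, abs_of_pos ha0, ← Finset.mul_sum]
    push_cast
    gcongr
  set Z := Fintype.piFinset fun _ : Fin (e + 1) =>
    Finset.Icc (-(((a * β : ℕ) : ℤ) + 1)) ((a * β : ℕ) + 1) with hZdef
  have hZ : ∀ z ∉ Z, ∀ u ∈ unitCube (e + 1),
      multiWindow (Bᵀ⁻¹ *ᵥ ((fun j => (z j : ℝ)) + u)) = 0 := fun z hz u hu =>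
    multiWindow_eq_zero_of_notMem hB hBsum hz hu
  have hZcard : Z.card ≤ m := by
    refine le_trans ?_ ham
    rw [hZdef, Fintype.card_piFinset, Finset.prod_const, Finset.card_univ, Fintype.card_fin,
      Int.card_Icc]
    refine Nat.pow_le_pow_left ?_ _
    have h1 : ((((a * β : ℕ) : ℤ) + 1) + 1 - -(((a * β : ℕ) : ℤ) + 1)).toNat = 2 * (a * β) + 3 := by
      omega
    rw [h1]
    nlinarith
  have hint := h₁ B hB Z hZ
  have hlat : ∑' n : Fin (e + 1) → ℤ, (if n = 0 then 0 else
      ENNReal.ofReal (∏ j, (1 + |(B *ᵥ fun i => (n i : ℝ)) j|) ^ (-(2 * r)))) ≤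
      ENNReal.ofReal (C₂ * (((a : ℝ) ^ (e + 1)) ^ (-(2 * r)) *
        (1 + Real.log ((a : ℝ) ^ (e + 1))) ^ e)) := by
    let M : (Fin (e + 1) → ℤ) →+ (Fin (e + 1) → ℝ) :=
      { toFun := fun n => B *ᵥ fun i => (n i : ℝ)
        map_zero' := by
          have : (fun i : Fin (e + 1) => (((0 : Fin (e + 1) → ℤ) i : ℤ) : ℝ)) = 0 := by
            ext; simp
          rw [this, mulVec_zero]
        map_add' := fun n n' => by
          rw [← mulVec_add]
          congr 1
          ext; simp }
    have hM : ∀ n, n ≠ 0 → (a : ℝ) ^ (e + 1) ≤ ∏ j, |M n j| := fun n hn => by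
      have h3 : ∀ j, |M n j| = a * |(L *ᵥ fun i => (n i : ℝ)) j| := fun j => by
        change |(B *ᵥ fun i => (n i : ℝ)) j| = _
        rw [hBdef, smul_mulVec, Pi.smul_apply, smul_eq_mul, abs_mul, abs_of_pos ha0]
      simp only [h3, Finset.prod_mul_distrib, ← Finset.abs_prod]
      simp only [Finset.prod_const, Finset.card_univ, Fintype.card_fin]
      exact le_mul_of_one_le_right (by positivity) (hadm n hn)
    rw [ENNReal.tsum_eq_iSup_sum]
    refine iSup_le fun s => ?_
    have h4 := h₂ ((a : ℝ) ^ (e + 1)) (one_le_pow₀ ha') M hM (s.erase 0) (by simp)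
    refine le_trans (le_of_eq ?_) (ENNReal.ofReal_le_ofReal h4)
    rw [ENNReal.ofReal_sum_of_nonneg fun n _ => Finset.prod_nonneg fun j _ => by positivity]
    rw [← Finset.sum_erase s (a := (0 : Fin (e + 1) → ℤ)) (by simp)]
    refine Finset.sum_congr rfl fun n hn => ?_
    rw [if_neg (Finset.ne_of_mem_erase hn)]
    rfl
  -- The cube has measure 1, so some shift does no worse than the average.
  obtain ⟨u, hu⟩ := exists_le_lintegral (μ := volume.restrict (unitCube (e + 1)))
    (f := fun u => ∑' q : (Fin (e + 1) → ℤ) × (Fin (e + 1) → ℤ), ENNReal.ofReal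
      (mixedWeight (2 * r) q.1 * mixedWeight (2 * r) q.2 *
        ‖shiftedCubature B Z (q.1 - q.2) u - if q.1 - q.2 = 0 then 1 else 0‖ ^ 2)) (by
      refine (Measurable.tsum fun q => ?_).aemeasurable
      have := (continuous_shiftedCubature B Z (q.1 - q.2)).measurable
      fun_prop)
  obtain ⟨ξ, w, hξw⟩ := exists_fin_reindex Z hZcard
    (fun z => torusPoint (Bᵀ⁻¹ *ᵥ ((fun j => (z j : ℝ)) + u)))
    (fun z => |B.det|⁻¹ * multiWindow (Bᵀ⁻¹ *ᵥ ((fun j => (z j : ℝ)) + u)))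
  have hQ : ∀ k : Fin (e + 1) → ℤ, ∑ j, (w j : ℂ) * torusMonomial k (ξ j) =
      shiftedCubature B Z k u := fun k => by
    rw [hξw, shiftedCubature]
    exact Finset.sum_congr rfl fun z _ => by rw [torusMonomial_torusPoint]
  refine optimalError_le_of_tsum_le hr ξ w (Real.sqrt_nonneg _) ?_
  simp only [hQ]
  have hlog : 0 ≤ Real.log ((a : ℝ) ^ (e + 1)) := Real.log_nonneg (one_le_pow₀ ha')
  rw [Real.sq_sqrt (by positivity)]
  refine hu.trans (hint.trans ?_)
  rw [mul_assoc C₁, ENNReal.ofReal_mul hC₁.le]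
  gcongr

/-- The upper bound for the optimal error. -/
theorem exists_optimalError_le (e : ℕ) {r : ℝ} (hr : 1 / 2 < r) :
    ∃ C : ℝ, 0 < C ∧ ∀ m : ℕ, 2 ≤ m →
      optimalError (torusMeasure (e + 1)) (mixedClass (e + 1) hr) 2 m ≤
        ENNReal.ofReal (C * ((m : ℝ) ^ (-r) * Real.log m ^ ((e : ℝ) / 2))) := by
  obtain ⟨C, β, hC, hβ, hlat⟩ := exists_optimalError_le_lattice e hr
  obtain ⟨K, hK, hconst⟩ := exists_optimalError_le_const (e + 1) hr
  have hβ' : (0 : ℝ) < β := by exact_mod_cast hβ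
  have hr0 : 0 < r := by linarith
  set N : ℝ := (β : ℝ) ^ (e + 1) with hN
  have hNpos : 0 < N := by positivity
  set C' : ℝ := √(C * (((2 * β : ℝ) ^ (e + 1)) ^ (2 * r) * 3 ^ e)) with hC'
  have hC'pos : 0 < C' := by rw [hC']; positivity
  have hl2 : 0 < Real.log 2 := Real.log_pos one_lt_two
  refine ⟨C' + K * (N ^ r * Real.log 2 ^ (-((e : ℝ) / 2))), by positivity, fun m hm => ?_⟩
  have hm2 : (2 : ℝ) ≤ m := by exact_mod_cast hm
  have hm0 : (0 : ℝ) < m := by linarith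
  have hlogm : Real.log 2 ≤ Real.log m := Real.log_le_log two_pos hm2
  have hlog0 : 0 < Real.log m := by linarith
  set R := (m : ℝ) ^ (-r) * Real.log m ^ ((e : ℝ) / 2) with hR
  have hR0 : 0 < R := by positivity
  -- For m < β^{e+1} no scale a ≥ 1 fits; there R is bounded below and the constant bound suffices.
  rcases lt_or_ge (m : ℝ) N with hsmall | hlarge
  · refine (hconst m).trans (ENNReal.ofReal_le_ofReal ?_)
    have h1 : 1 ≤ N ^ r * (m : ℝ) ^ (-r) := by
      rw [Real.rpow_neg hm0.le, ← div_eq_mul_inv, one_le_div (by positivity)]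
      exact Real.rpow_le_rpow hm0.le hsmall.le hr0.le
    have h2 : 1 ≤ Real.log 2 ^ (-((e : ℝ) / 2)) * Real.log m ^ ((e : ℝ) / 2) := by
      rw [Real.rpow_neg hl2.le, mul_comm, ← div_eq_mul_inv, one_le_div (by positivity)]
      exact Real.rpow_le_rpow hl2.le hlogm (by positivity)
    calc K ≤ K * ((N ^ r * (m : ℝ) ^ (-r)) *
          (Real.log 2 ^ (-((e : ℝ) / 2)) * Real.log m ^ ((e : ℝ) / 2))) :=
          le_mul_of_one_le_right hK.le (one_le_mul_of_one_le_of_one_le h1 h2)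
      _ = K * (N ^ r * Real.log 2 ^ (-((e : ℝ) / 2))) * R := by rw [hR]; ring
      _ ≤ _ := by
        rw [add_mul]
        have := mul_pos hC'pos hR0
        linarith
  · set t : ℝ := (m : ℝ) ^ ((1 : ℝ) / (e + 1)) / β with ht
    have htpow : (t * β) ^ (e + 1) = m := by
      rw [ht, div_mul_cancel₀ _ hβ'.ne', ← Real.rpow_natCast, ← Real.rpow_mul hm0.le]
      have : (1 : ℝ) / (e + 1) * ((e + 1 : ℕ) : ℝ) = 1 := by
        push_cast
        field_simp
      rw [this, Real.rpow_one]
    have ht0 : 0 < t := by positivity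
    have ht1 : 1 ≤ t := by
      have h1 : (β : ℝ) ^ (e + 1) ≤ (t * β) ^ (e + 1) := by rw [htpow]; exact hlarge
      have h2 := (pow_le_pow_iff_left₀ hβ'.le (by positivity) (Nat.succ_ne_zero e)).1 h1
      exact (le_mul_iff_one_le_left hβ').1 h2
    set a := ⌊t⌋₊ with ha
    have ha1 : 1 ≤ a := Nat.le_floor (by simpa using ht1)
    have hat : (a : ℝ) ≤ t := Nat.floor_le ht0.le
    have hta : t < a + 1 := Nat.lt_floor_add_one t
    have ha1' : (1 : ℝ) ≤ a := by exact_mod_cast ha1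
    have ham : (a * β) ^ (e + 1) ≤ m := by
      have : ((a : ℝ) * β) ^ (e + 1) ≤ m := by
        rw [← htpow]
        gcongr
      exact_mod_cast this
    refine (hlat a m ha1 ham).trans (ENNReal.ofReal_le_ofReal ?_)
    set V : ℝ := (a : ℝ) ^ (e + 1) with hV
    have hV0 : 0 < V := by positivity
    have hVm : V ≤ m := by
      have h1 : ((a : ℝ) * 1) ^ (e + 1) ≤ ((a : ℝ) * β) ^ (e + 1) := by
        have : (1 : ℝ) ≤ β := by exact_mod_cast hβ
        gcongr
      rw [mul_one] at h1
      refine h1.trans ?_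
      exact_mod_cast ham
    -- The factor 2 comes from t < a + 1 ≤ 2a, so rounding down costs only a constant.
    have hmV : (m : ℝ) ≤ (2 * β : ℝ) ^ (e + 1) * V := by
      rw [← htpow, hV, ← mul_pow]
      refine pow_le_pow_left₀ (by positivity) ?_ _
      nlinarith
    have h1 : V ^ (-(2 * r)) ≤ ((2 * β : ℝ) ^ (e + 1)) ^ (2 * r) * (m : ℝ) ^ (-(2 * r)) := by
      rw [Real.rpow_neg hV0.le, Real.rpow_neg hm0.le, ← div_eq_mul_inv, inv_eq_one_div,
        div_le_div_iff₀ (by positivity) (by positivity), one_mul, ← Real.mul_rpow (by positivity)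
        hV0.le]
      exact Real.rpow_le_rpow hm0.le hmV (by linarith)
    have h2 : 1 + Real.log V ≤ 3 * Real.log m := by
      have h3 : Real.log V ≤ Real.log m := Real.log_le_log hV0 hVm
      have h4 := Real.log_two_gt_d9
      linarith
    have hlogV : 0 ≤ Real.log V := Real.log_nonneg (one_le_pow₀ ha1')
    have h5 : C * (V ^ (-(2 * r)) * (1 + Real.log V) ^ e) ≤
        C * (((2 * β : ℝ) ^ (e + 1)) ^ (2 * r) * 3 ^ e) * R ^ 2 := by
      have h6 : R ^ 2 = (m : ℝ) ^ (-(2 * r)) * Real.log m ^ e := by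
        rw [hR, mul_pow, ← Real.rpow_natCast, ← Real.rpow_natCast (Real.log m ^ ((e : ℝ) / 2)),
          ← Real.rpow_mul hm0.le, ← Real.rpow_mul hlog0.le, ← Real.rpow_natCast (Real.log m)]
        congr 2
        · push_cast; ring
        · push_cast; ring
      rw [h6]
      calc _ ≤ C * ((((2 * β : ℝ) ^ (e + 1)) ^ (2 * r) * (m : ℝ) ^ (-(2 * r))) *
            (3 * Real.log m) ^ e) := by gcongr
        _ = _ := by rw [mul_pow]; ring
    calc √(C * (V ^ (-(2 * r)) * (1 + Real.log V) ^ e))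
        ≤ √(C * (((2 * β : ℝ) ^ (e + 1)) ^ (2 * r) * 3 ^ e) * R ^ 2) := Real.sqrt_le_sqrt h5
      _ = C' * R := by
          rw [Real.sqrt_mul' _ (sq_nonneg R), Real.sqrt_sq hR0.le]
      _ ≤ _ := by
          rw [add_mul]
          have : 0 < K * (N ^ r * Real.log 2 ^ (-((e : ℝ) / 2))) * R := by positivity
          linarith

end UpperBound

/-! ### The lower bound -/

section LowerBound

/-- For any `m` points there is a trigonometric polynomial with values in `[0, 1]` and frequencies
in a box of dimension at least `2m` which vanishes at the points and has mean at least `1/2`. -/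
theorem exists_fooling {d m : ℕ} (ξ : Fin m → Torus d) (s : Fin d → ℕ)
    (hs : 2 * m ≤ 2 ^ ∑ j, s j) :
    ∃ (a : (Fin d → ℤ) → ℂ) (g : Torus d → ℝ), (∀ k, a k ≠ 0 → ∀ j, starAbs (k j) ≤ 2 ^ s j) ∧
      (∀ (F : Finset (Fin d → ℤ)), (∀ k, a k ≠ 0 → k ∈ F) →
        ∀ x, ((g x : ℝ) : ℂ) = ∑ k ∈ F, a k * torusMonomial k x) ∧
      (∀ j, g (ξ j) = 0) ∧ (∀ x, |g x| ≤ 1) ∧ 1 / 2 ≤ (a 0).re := by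
  classical
  set R : Finset (Fin d → ℤ) := Fintype.piFinset fun j => Finset.Ico (0 : ℤ) (2 ^ s j) with hR
  have hRcard : R.card = 2 ^ ∑ j, s j := by
    rw [hR, Fintype.card_piFinset, ← Finset.prod_pow_eq_pow_sum]
    refine Finset.prod_congr rfl fun j _ => ?_
    rw [Int.card_Ico, sub_zero]
    exact_mod_cast Int.toNat_natCast (2 ^ s j)
  set N : ℝ := (R.card : ℝ) with hN
  have hNpos : 0 < N := by
    rw [hN, hRcard]
    positivity
  set v : Torus d → EuclideanSpace ℂ R := fun x => WithLp.toLp 2 fun k => torusMonomial k.1 x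
    with hv
  have hvnorm : ∀ x, ‖v x‖ ^ 2 = N := fun x => by
    rw [EuclideanSpace.norm_sq_eq]
    simp [hv, norm_torusMonomial, hN]
  set S := Submodule.span ℂ (Set.range fun j => v (ξ j)) with hS
  have hrank : Module.finrank ℂ S ≤ m := by
    exact (finrank_range_le_card (R := ℂ) fun j => v (ξ j)).trans (by simp)
  set b := stdOrthonormalBasis ℂ S with hb
  have hbon : Orthonormal ℂ fun i => (b i : EuclideanSpace ℂ R) :=
    b.orthonormal.comp_linearIsometry S.subtypeₗᵢ
  -- h(x) is the squared length of the projection of v(x) onto the span S of the node vectors. It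
  -- equals N at the nodes, never exceeds N, and has mean dim S ≤ m ≤ N/2. The function sought is 1
  -- - h/N.
  set h : Torus d → ℝ := fun x => ∑ i, ‖inner ℂ (b i : EuclideanSpace ℂ R) (v x)‖ ^ 2 with hh
  have hle : ∀ x, h x ≤ N := fun x => by
    rw [← hvnorm x]
    exact hbon.sum_inner_products_le (v x)
  have hpos : ∀ x, 0 ≤ h x := fun x => Finset.sum_nonneg fun _ _ => by positivity
  have hnode : ∀ j, h (ξ j) = N := fun j => by
    have hmem : v (ξ j) ∈ S := Submodule.subset_span ⟨j, rfl⟩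
    have h1 := b.sum_sq_norm_inner_right ⟨v (ξ j), hmem⟩
    rw [← hvnorm (ξ j)]
    simpa using h1
  set P : (Fin d → ℤ) × (Fin d → ℤ) → ℂ := fun q =>
    if hq : q.1 ∈ R ∧ q.2 ∈ R then ∑ i, conj ((b i : EuclideanSpace ℂ R) ⟨q.1, hq.1⟩) *
      (b i : EuclideanSpace ℂ R) ⟨q.2, hq.2⟩ else 0 with hP
  have hhP : ∀ x, ((h x : ℝ) : ℂ) = ∑ q ∈ R ×ˢ R, P q * torusMonomial (q.1 - q.2) x := fun x => by
    have h1 : ∀ i, inner ℂ (b i : EuclideanSpace ℂ R) (v x) =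
        ∑ k : R, conj ((b i : EuclideanSpace ℂ R) k) * torusMonomial k.1 x := fun i => by
      rw [PiLp.inner_apply]
      refine Finset.sum_congr rfl fun k _ => ?_
      rw [RCLike.inner_apply, mul_comm]
    rw [hh, Complex.ofReal_sum]
    simp only [Complex.ofReal_pow]
    simp only [← Complex.mul_conj', h1, map_sum, map_mul, Complex.conj_conj, Finset.sum_mul_sum]
    rw [Finset.sum_product, ← Finset.sum_coe_sort R, Finset.sum_comm]
    refine Finset.sum_congr rfl fun k _ => ?_
    rw [← Finset.sum_coe_sort R, Finset.sum_comm]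
    refine Finset.sum_congr rfl fun l _ => ?_
    have h2 : P (k.1, l.1) = ∑ i, conj ((b i : EuclideanSpace ℂ R) k) *
        (b i : EuclideanSpace ℂ R) l := by
      rw [hP]
      exact dif_pos ⟨k.2, l.2⟩
    rw [h2, torusMonomial_sub_index, Finset.sum_mul]
    exact Finset.sum_congr rfl fun i _ => by ring
  -- The zero Fourier coefficient of h is the trace of the projection, hence its rank.
  have htrace : ∑ k ∈ R, P (k, k) = (Module.finrank ℂ S : ℂ) := by
    have h1 : ∀ k : R, P (k.1, k.1) =
        ∑ i, ((‖(b i : EuclideanSpace ℂ R) k‖ ^ 2 : ℝ) : ℂ) := fun k => by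
      have h2 : P (k.1, k.1) = ∑ i, conj ((b i : EuclideanSpace ℂ R) k) *
          (b i : EuclideanSpace ℂ R) k := by
        rw [hP]
        exact dif_pos ⟨k.2, k.2⟩
      rw [h2]
      refine Finset.sum_congr rfl fun i _ => ?_
      rw [Complex.conj_mul']
      push_cast
      rfl
    rw [← Finset.sum_coe_sort R]
    simp only [h1]
    rw [Finset.sum_comm]
    have h3 : ∀ i, ∑ k : R, ((‖(b i : EuclideanSpace ℂ R) k‖ ^ 2 : ℝ) : ℂ) = 1 := fun i => by
      rw [← Complex.ofReal_sum, ← EuclideanSpace.norm_sq_eq, hbon.norm_eq_one]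
      simp
    rw [Finset.sum_congr rfl fun i _ => h3 i]
    simp
  set D : Finset (Fin d → ℤ) := (R ×ˢ R).image fun q => q.1 - q.2 with hD
  set a : (Fin d → ℤ) → ℂ := fun k => (if k = 0 then 1 else 0) -
    (N : ℂ)⁻¹ * ∑ q ∈ R ×ˢ R with q.1 - q.2 = k, P q with ha
  refine ⟨a, fun x => 1 - N⁻¹ * h x, fun k hk j => ?_, fun F hF x => ?_, fun j => ?_, fun x => ?_,
    ?_⟩
  · by_cases hk0 : k = 0
    · subst hk0
      simp only [Pi.zero_apply, starAbs, Int.cast_zero, abs_zero]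
      rw [max_eq_right zero_le_one]
      exact one_le_pow₀ one_le_two
    · have hne : ((R ×ˢ R).filter fun q => q.1 - q.2 = k).Nonempty := by
        by_contra hemp
        rw [Finset.not_nonempty_iff_eq_empty] at hemp
        refine hk ?_
        simp only [ha]
        rw [hemp, if_neg hk0]
        simp
      obtain ⟨q, hq⟩ := hne
      rw [Finset.mem_filter, Finset.mem_product] at hq
      obtain ⟨⟨h1, h2⟩, rfl⟩ := hq
      have h3 := Finset.mem_Ico.1 (Fintype.mem_piFinset.1 h1 j)
      have h4 := Finset.mem_Ico.1 (Fintype.mem_piFinset.1 h2 j)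
      refine max_le ?_ (one_le_pow₀ one_le_two)
      have h5 : |q.1 j - q.2 j| ≤ 2 ^ s j := abs_le.2 ⟨by linarith [h3.1, h4.2],
        by linarith [h3.2, h4.1]⟩
      rw [Pi.sub_apply]
      exact_mod_cast h5
  · have hext : ∑ k ∈ F, a k * torusMonomial k x = ∑ k ∈ F ∪ (insert 0 D), a k * torusMonomial k x := by
      refine Finset.sum_subset Finset.subset_union_left fun k _ hk => ?_
      have : a k = 0 := by
        by_contra h0
        exact hk (hF k h0)
      rw [this, zero_mul]
    rw [hext]
    simp only [ha, sub_mul, Finset.sum_sub_distrib]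
    have h1 : ∑ k ∈ F ∪ insert 0 D, (if k = 0 then (1 : ℂ) else 0) * torusMonomial k x = 1 := by
      rw [Finset.sum_eq_single 0]
      · simp [torusMonomial_zero]
      · intro k _ hk
        simp [hk]
      · intro h0
        exact absurd (Finset.mem_union_right _ (Finset.mem_insert_self _ _)) h0
    have h2 : ∑ k ∈ F ∪ insert 0 D, ((N : ℂ)⁻¹ * ∑ q ∈ R ×ˢ R with q.1 - q.2 = k, P q) *
        torusMonomial k x = (N : ℂ)⁻¹ * ∑ q ∈ R ×ˢ R, P q * torusMonomial (q.1 - q.2) x := by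
      rw [← Finset.sum_fiberwise_of_maps_to (g := fun q : (Fin d → ℤ) × (Fin d → ℤ) => q.1 - q.2)
        (t := F ∪ insert 0 D) fun q hq => Finset.mem_union_right _
          (Finset.mem_insert_of_mem (Finset.mem_image_of_mem _ hq)), Finset.mul_sum]
      refine Finset.sum_congr rfl fun k _ => ?_
      rw [mul_assoc, Finset.sum_mul]
      congr 1
      refine Finset.sum_congr rfl fun q hq => ?_
      rw [(Finset.mem_filter.1 hq).2]
    rw [h1, h2, ← hhP]
    push_cast
    rfl
  · simp only [hnode j]
    rw [inv_mul_cancel₀ hNpos.ne', sub_self]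
  · have h1 : 0 ≤ N⁻¹ * h x := mul_nonneg (inv_nonneg.2 hNpos.le) (hpos x)
    have h2 : N⁻¹ * h x ≤ 1 := by
      rw [inv_mul_le_iff₀ hNpos, mul_one]
      exact hle x
    exact abs_le.2 ⟨by linarith, by linarith⟩
  · have h1 : ∑ q ∈ R ×ˢ R with q.1 - q.2 = 0, P q = ∑ k ∈ R, P (k, k) := by
      symm
      refine Finset.sum_bij (fun k _ => (k, k)) (fun k hk => ?_) (fun k _ l _ hkl => ?_)
        (fun q hq => ?_) fun _ _ => rfl
      · simp [hk]
      · exact congrArg Prod.fst hkl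
      · rw [Finset.mem_filter, Finset.mem_product] at hq
        exact ⟨q.1, hq.1.1, Prod.ext rfl (sub_eq_zero.1 hq.2)⟩
    simp only [ha, if_true]
    rw [h1, htrace]
    have h2 : (1 - (N : ℂ)⁻¹ * (Module.finrank ℂ S : ℂ)) =
        ((1 - N⁻¹ * (Module.finrank ℂ S : ℝ) : ℝ) : ℂ) := by
      push_cast
      rfl
    rw [h2, Complex.ofReal_re]
    have h3 : 2 * (Module.finrank ℂ S : ℝ) ≤ N := by
      rw [hN, hRcard]
      exact_mod_cast (Nat.mul_le_mul_left 2 hrank).trans hs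
    have h4 : N⁻¹ * (Module.finrank ℂ S : ℝ) ≤ 1 / 2 := by
      rw [inv_mul_le_iff₀ hNpos]
      linarith
    linarith

theorem sum_dyadic_le {p : ℝ} (hp : 1 ≤ p) {x : ℝ} (hx : 0 < x) (n : ℕ) :
    ∑ i ∈ Finset.range n, (if x ≤ 2 ^ i then (x / 2 ^ i) ^ p else 0) ≤ 2 := by
  classical
  have hex : ∃ i : ℕ, x ≤ 2 ^ i := by
    obtain ⟨i, hi⟩ := pow_unbounded_of_one_lt x one_lt_two
    exact ⟨i, hi.le⟩
  set i₀ := Nat.find hex with hi₀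
  have hspec : x ≤ 2 ^ i₀ := Nat.find_spec hex
  calc _ ≤ ∑ i ∈ Finset.range n, if i₀ ≤ i then ((1 : ℝ) / 2) ^ (i - i₀) else 0 := by
        refine Finset.sum_le_sum fun i _ => ?_
        split_ifs with h1 h2 h2
        · have h3 : x / 2 ^ i ≤ 1 := by rwa [div_le_one (by positivity)]
          calc (x / 2 ^ i) ^ p ≤ (x / 2 ^ i) ^ (1 : ℝ) :=
                Real.rpow_le_rpow_of_exponent_ge (by positivity) h3 hp
            _ = x / 2 ^ i := Real.rpow_one _
            _ ≤ 2 ^ i₀ / 2 ^ i := by gcongr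
            _ = _ := by
              rw [div_pow, one_pow, div_eq_div_iff (by positivity) (by positivity), one_mul,
                ← pow_add]
              congr 1
              omega
        · exact absurd (Nat.find_min' hex h1) h2
        · positivity
        · exact le_rfl
    _ = ∑ i ∈ Finset.Ico i₀ n, ((1 : ℝ) / 2) ^ (i - i₀) := by
        rw [← Finset.sum_filter]
        refine Finset.sum_congr ?_ fun _ _ => rfl
        ext i
        simp [and_comm]
    _ ≤ 2 := by
        rw [Finset.sum_Ico_eq_sum_range]
        simp only [Nat.add_sub_cancel_left]
        exact sum_geometric_two_le _

/-- For each counted s the weight is 2^{np} ∏ (k_j^* / 2^{s_j})^p. Dropping the constraint on the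
sum of s, the total factorizes into d geometric series, each at most 2. -/
theorem mixedWeight_mul_card_le {d : ℕ} {p : ℝ} (hp : 1 ≤ p) (n : ℕ) (k : Fin d → ℤ) :
    mixedWeight (-p) k * (((Finset.piAntidiag (Finset.univ : Finset (Fin d)) n).filter
      fun s => ∀ j, starAbs (k j) ≤ 2 ^ s j).card : ℝ) ≤ 2 ^ d * ((2 : ℝ) ^ n) ^ p := by
  set A := (Finset.piAntidiag (Finset.univ : Finset (Fin d)) n).filter
      fun s => ∀ j, starAbs (k j) ≤ 2 ^ s j with hA
  have hterm : ∀ s ∈ A, mixedWeight (-p) k = ((2 : ℝ) ^ n) ^ p *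
      ∏ j, (if starAbs (k j) ≤ 2 ^ s j then (starAbs (k j) / 2 ^ s j) ^ p else 0) := fun s hs => by
    rw [hA, Finset.mem_filter, Finset.mem_piAntidiag] at hs
    have h1 : ((2 : ℝ) ^ n) ^ p = ∏ j, ((2 : ℝ) ^ s j) ^ p := by
      rw [Real.finsetProd_rpow _ _ fun _ _ => by positivity, Finset.prod_pow_eq_pow_sum, hs.1.1]
    rw [h1, ← Finset.prod_mul_distrib, mixedWeight]
    refine Finset.prod_congr rfl fun j _ => ?_
    have h0 := starAbs_pos (k j)
    rw [if_pos (hs.2 j), ← Real.mul_rpow (by positivity) (by positivity),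
      mul_div_cancel₀ _ (by positivity), neg_neg]
  have hsub : A ⊆ Fintype.piFinset fun _ : Fin d => Finset.range (n + 1) := fun s hs => by
    rw [hA, Finset.mem_filter, Finset.mem_piAntidiag] at hs
    refine Fintype.mem_piFinset.2 fun j => Finset.mem_range.2 ?_
    have := Finset.single_le_sum (f := s) (fun _ _ => Nat.zero_le _) (Finset.mem_univ j)
    rw [hs.1.1] at this
    omega
  have hnn : ∀ (s : Fin d → ℕ), 0 ≤ ∏ j, (if starAbs (k j) ≤ 2 ^ s j then
      (starAbs (k j) / 2 ^ s j) ^ p else 0) := fun s => Finset.prod_nonneg fun j _ => by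
    have h0 := starAbs_pos (k j)
    split_ifs <;> positivity
  calc mixedWeight (-p) k * (A.card : ℝ) = ∑ s ∈ A, mixedWeight (-p) k := by
        rw [Finset.sum_const, nsmul_eq_mul, mul_comm]
    _ = ∑ s ∈ A, ((2 : ℝ) ^ n) ^ p *
      ∏ j, (if starAbs (k j) ≤ 2 ^ s j then (starAbs (k j) / 2 ^ s j) ^ p else 0) :=
        Finset.sum_congr rfl hterm
    _ ≤ ((2 : ℝ) ^ n) ^ p * ∑ s ∈ Fintype.piFinset fun _ : Fin d => Finset.range (n + 1),
      ∏ j, (if starAbs (k j) ≤ 2 ^ s j then (starAbs (k j) / 2 ^ s j) ^ p else 0) := by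
        rw [← Finset.mul_sum]
        gcongr
        exact fun s _ _ => hnn s
    _ = ((2 : ℝ) ^ n) ^ p * ∏ j, ∑ i ∈ Finset.range (n + 1),
      (if starAbs (k j) ≤ 2 ^ i then (starAbs (k j) / 2 ^ i) ^ p else 0) := by
        rw [Finset.prod_univ_sum]
    _ ≤ ((2 : ℝ) ^ n) ^ p * ∏ _j : Fin d, 2 := by
        gcongr with j _
        · intro j _
          refine Finset.sum_nonneg fun i _ => ?_
          have h0 := starAbs_pos (k j)
          split_ifs <;> positivity
        · exact sum_dyadic_le hp (starAbs_pos _) _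
    _ = _ := by
        rw [Finset.prod_const, Finset.card_univ, Fintype.card_fin, mul_comm]

/-- The test functions are 1/2 ± τG, with G the sum of the fooling polynomials over all boxes. The
constant 1/2 makes the quadratic functional respond linearly to G, so the mean of G enters. -/
theorem le_optimalError {d m n : ℕ} {r : ℝ} (hr : 1 / 2 < r) (hmn : 2 * m ≤ 2 ^ n)
    (hA : (Finset.piAntidiag (Finset.univ : Finset (Fin d)) n).Nonempty) :
    ENNReal.ofReal (√((Finset.piAntidiag (Finset.univ : Finset (Fin d)) n).card) /
      (4 * √(2 ^ d) * ((2 : ℝ) ^ n) ^ r)) ≤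
      optimalError (torusMeasure d) (realMixedClass d hr) 2 m := by
  classical
  refine le_iInf₂ fun ξ w => ?_
  set A := Finset.piAntidiag (Finset.univ : Finset (Fin d)) n with hAdef
  have hsum : ∀ s ∈ A, ∑ j, s j = n := fun s hs => (Finset.mem_piAntidiag.1 hs).1
  have hfool : ∀ s : Fin d → ℕ, ∃ (a : (Fin d → ℤ) → ℂ) (g : Torus d → ℝ), s ∈ A →
      (∀ k, a k ≠ 0 → ∀ j, starAbs (k j) ≤ 2 ^ s j) ∧
      (∀ (F : Finset (Fin d → ℤ)), (∀ k, a k ≠ 0 → k ∈ F) →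
        ∀ x, ((g x : ℝ) : ℂ) = ∑ k ∈ F, a k * torusMonomial k x) ∧
      (∀ j, g (ξ j) = 0) ∧ (∀ x, |g x| ≤ 1) ∧ 1 / 2 ≤ (a 0).re := fun s => by
    by_cases hs : s ∈ A
    · obtain ⟨a, g, h⟩ := exists_fooling ξ s (by rw [hsum s hs]; exact hmn)
      exact ⟨a, g, fun _ => h⟩
    · exact ⟨0, 0, fun h => absurd h hs⟩
  choose a g hag using hfool
  set F : Finset (Fin d → ℤ) := Fintype.piFinset fun _ => Finset.Icc (-(2 ^ n : ℤ)) (2 ^ n) with hF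
  have h0F : (0 : Fin d → ℤ) ∈ F := Fintype.mem_piFinset.2 fun j => by simp
  have hFmem : ∀ s ∈ A, ∀ k, a s k ≠ 0 → k ∈ F := fun s hs k hk => by
    refine Fintype.mem_piFinset.2 fun j => Finset.mem_Icc.2 (abs_le.1 ?_)
    have h1 : |(k j : ℝ)| ≤ 2 ^ s j := (le_max_left _ _).trans ((hag s hs).1 k hk j)
    have h2 : (2 : ℝ) ^ s j ≤ 2 ^ n := by
      refine pow_le_pow_right₀ one_le_two ?_
      rw [← hsum s hs]
      exact Finset.single_le_sum (f := s) (fun _ _ => Nat.zero_le _) (Finset.mem_univ j)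
    exact_mod_cast h1.trans h2
  have hgF : ∀ s ∈ A, ∀ x, ((g s x : ℝ) : ℂ) = ∑ k ∈ F, a s k * torusMonomial k x := fun s hs =>
    (hag s hs).2.1 F (hFmem s hs)
  have hbessel : ∀ s ∈ A, ∑ k ∈ F, ‖a s k‖ ^ 2 ≤ 1 := fun s hs => by
    rw [← integral_sq_sum_torusMonomial]
    simp only [← hgF s hs, Complex.norm_real, Real.norm_eq_abs]
    have h1 : ∫ x, |g s x| ^ 2 ∂torusMeasure d ≤ ∫ _x, (1 : ℝ) ∂torusMeasure d := by
      refine integral_mono_of_nonneg (Filter.Eventually.of_forall fun x => by positivity)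
        (integrable_const _) (Filter.Eventually.of_forall fun x => ?_)
      exact pow_le_one₀ (abs_nonneg _) ((hag s hs).2.2.2.1 x)
    simpa using h1
  set c : (Fin d → ℤ) → ℂ := fun k => ∑ s ∈ A, a s k with hc
  set G : Torus d → ℝ := fun x => ∑ s ∈ A, g s x with hG
  have hGc : ∀ x, ((G x : ℝ) : ℂ) = ∑ k ∈ F, c k * torusMonomial k x := fun x => by
    simp only [hG, hc, Complex.ofReal_sum, Finset.sum_mul]
    rw [Finset.sum_comm]
    exact Finset.sum_congr rfl fun s hs => hgF s hs x
  have hGnode : ∀ j, G (ξ j) = 0 := fun j =>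
    Finset.sum_eq_zero fun s hs => (hag s hs).2.2.1 j
  have hcard : (0 : ℝ) < A.card := by exact_mod_cast hA.card_pos
  set K : ℝ := 2 ^ d * ((2 : ℝ) ^ n) ^ (2 * r) with hK
  have hKpos : 0 < K := by positivity
  have hcnorm : ∑ k ∈ F, mixedWeight (-(2 * r)) k * ‖c k‖ ^ 2 ≤ K * A.card := by
    have h1 : ∀ k ∈ F, mixedWeight (-(2 * r)) k * ‖c k‖ ^ 2 ≤ K * ∑ s ∈ A, ‖a s k‖ ^ 2 := by
      intro k _
      -- Only the boxes containing k contribute to c k. Cauchy–Schwarz costs their number, which the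
      -- smoothness weight keeps under control.
      set A' := A.filter fun s => ∀ j, starAbs (k j) ≤ 2 ^ s j with hA'
      have h2 : c k = ∑ s ∈ A', a s k := by
        rw [hc, hA', Finset.sum_filter_of_ne]
        exact fun s hs hne => (hag s hs).1 k hne
      have h3 : ‖c k‖ ^ 2 ≤ A'.card * ∑ s ∈ A, ‖a s k‖ ^ 2 := by
        calc ‖c k‖ ^ 2 ≤ (∑ s ∈ A', ‖a s k‖) ^ 2 := by
              rw [h2]
              exact pow_le_pow_left₀ (norm_nonneg _) (norm_sum_le _ _) 2
          _ ≤ A'.card * ∑ s ∈ A', ‖a s k‖ ^ 2 := sq_sum_le_card_mul_sum_sq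
          _ ≤ A'.card * ∑ s ∈ A, ‖a s k‖ ^ 2 := by
              gcongr
              exact Finset.filter_subset _ _
      calc _ ≤ mixedWeight (-(2 * r)) k * (A'.card * ∑ s ∈ A, ‖a s k‖ ^ 2) :=
            mul_le_mul_of_nonneg_left h3 (mixedWeight_pos _ _).le
        _ = (mixedWeight (-(2 * r)) k * A'.card) * ∑ s ∈ A, ‖a s k‖ ^ 2 := by ring
        _ ≤ _ := mul_le_mul_of_nonneg_right
            (mixedWeight_mul_card_le (by linarith) n k)
            (Finset.sum_nonneg fun _ _ => by positivity)
    calc _ ≤ ∑ k ∈ F, K * ∑ s ∈ A, ‖a s k‖ ^ 2 := Finset.sum_le_sum h1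
      _ = K * ∑ s ∈ A, ∑ k ∈ F, ‖a s k‖ ^ 2 := by rw [← Finset.mul_sum, Finset.sum_comm]
      _ ≤ K * ∑ _s ∈ A, 1 := by
          gcongr with s hs
          exact hbessel s hs
      _ = _ := by simp
  -- Chosen so that the constant and the multiple of G each use half of the unit budget: 2·(1/4) and
  -- 2τ²K|A|.
  set τ : ℝ := 1 / (2 * √(K * A.card)) with hτ
  have hτpos : 0 < τ := by positivity
  have hτsq : τ ^ 2 * (K * A.card) = 1 / 4 := by
    rw [hτ, div_pow, mul_pow, Real.sq_sqrt (by positivity)]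
    field_simp
    norm_num
  have hmem : ∀ σ : ℝ, σ ^ 2 = τ ^ 2 →
      (fun x => ((1 / 2 + σ * G x : ℝ) : ℂ)) ∈ realMixedClass d hr := fun σ hσ => by
    refine ⟨?_, fun x => Complex.ofReal_im _⟩
    have h1 : (fun x => ((1 / 2 + σ * G x : ℝ) : ℂ)) = fun x =>
        ∑ k ∈ F, ((if k = 0 then 1 / 2 else 0) + σ * c k) * torusMonomial k x := by
      funext x
      simp only [add_mul, Finset.sum_add_distrib, mul_assoc, ← Finset.mul_sum, ← hGc]
      have h2 : ∑ k ∈ F, (if k = 0 then (1 / 2 : ℂ) else 0) * torusMonomial k x = 1 / 2 := by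
        rw [Finset.sum_eq_single 0]
        · simp [torusMonomial_zero]
        · intro k _ hk
          simp [hk]
        · exact fun h => absurd h0F h
      rw [h2]
      push_cast
      rfl
    rw [h1]
    refine sum_mem_mixedClass hr F _ ?_
    have h3 : ∀ k ∈ F, mixedWeight (-(2 * r)) k *
        ‖(if k = 0 then (1 / 2 : ℂ) else 0) + σ * c k‖ ^ 2 ≤
        (if k = 0 then 1 / 2 else 0) + 2 * τ ^ 2 * (mixedWeight (-(2 * r)) k * ‖c k‖ ^ 2) := by
      intro k _
      have h4 : ‖(if k = 0 then (1 / 2 : ℂ) else 0) + σ * c k‖ ^ 2 ≤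
          2 * (‖(if k = 0 then (1 / 2 : ℂ) else 0)‖ ^ 2 + ‖σ * c k‖ ^ 2) :=
        (pow_le_pow_left₀ (norm_nonneg _) (norm_add_le _ _) 2).trans add_sq_le
      have h5 : ‖σ * c k‖ ^ 2 = τ ^ 2 * ‖c k‖ ^ 2 := by
        rw [norm_mul, mul_pow, Complex.norm_real, Real.norm_eq_abs, sq_abs, hσ]
      rw [h5] at h4
      have h6 := mixedWeight_pos (-(2 * r)) k
      refine (mul_le_mul_of_nonneg_left h4 h6.le).trans (le_of_eq ?_)
      split_ifs with hk
      · rw [hk, mixedWeight_zero]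
        norm_num
        ring
      · simp
        ring
    refine (Finset.sum_le_sum h3).trans ?_
    rw [Finset.sum_add_distrib, ← Finset.mul_sum, Finset.sum_ite_eq' F 0, if_pos h0F]
    have h7 : 2 * τ ^ 2 * ∑ k ∈ F, mixedWeight (-(2 * r)) k * ‖c k‖ ^ 2 ≤
        2 * τ ^ 2 * (K * A.card) := by gcongr
    linarith
  set err : (Torus d → ℂ) → ℝ := fun f =>
    ∫ x, ‖f x‖ ^ (2 : ℝ) ∂torusMeasure d - ∑ j, w j * ‖f (ξ j)‖ ^ (2 : ℝ) with herr
  have hGint : Integrable (fun x => ((G x : ℝ) : ℂ)) (torusMeasure d) := by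
    simp only [hGc]
    exact (memLp_sum_torusMonomial F c 1).integrable le_rfl
  have hGint' : Integrable G (torusMeasure d) := by
    simpa using hGint.re
  have hG2 : Integrable (fun x => G x ^ 2) (torusMeasure d) := by
    have h1 : MemLp (fun x => ((G x : ℝ) : ℂ)) 2 (torusMeasure d) := by
      simp only [hGc]
      exact memLp_sum_torusMonomial F c 2
    have h2 := h1.integrable_norm_pow (by norm_num)
    simpa [Complex.norm_real] using h2
  have hmean : (A.card : ℝ) / 2 ≤ ∫ x, G x ∂torusMeasure d := by
    have h1 : ∫ x, ((G x : ℝ) : ℂ) ∂torusMeasure d = c 0 := by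
      have h2 := torusFourierCoeff_sum F c 0
      rw [if_pos h0F, torusFourierCoeff_eq] at h2
      rw [← h2]
      refine integral_congr_ae (Filter.Eventually.of_forall fun x => ?_)
      simp only [neg_zero, torusMonomial_zero, one_mul, hGc]
    rw [integral_complex_ofReal] at h1
    have h2 := congrArg Complex.re h1
    rw [Complex.ofReal_re] at h2
    rw [h2, hc, Complex.re_sum]
    calc (A.card : ℝ) / 2 = ∑ _s ∈ A, (1 / 2 : ℝ) := by
          rw [Finset.sum_const, nsmul_eq_mul]
          ring
      _ ≤ _ := Finset.sum_le_sum fun s hs => (hag s hs).2.2.2.2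
  have herrσ : ∀ σ : ℝ, err (fun x => ((1 / 2 + σ * G x : ℝ) : ℂ)) =
      1 / 4 + σ * ∫ x, G x ∂torusMeasure d + σ ^ 2 * ∫ x, G x ^ 2 ∂torusMeasure d -
        ∑ j, w j * (1 / 4) := fun σ => by
    have h1 : ∀ x, ‖((1 / 2 + σ * G x : ℝ) : ℂ)‖ ^ (2 : ℝ) =
        1 / 4 + σ * G x + σ ^ 2 * G x ^ 2 := fun x => by
      rw [Complex.norm_real, Real.rpow_two, Real.norm_eq_abs, sq_abs]
      ring
    simp only [herr, h1, hGnode]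
    have h2 : Integrable (fun x => 1 / 4 + σ * G x) (torusMeasure d) :=
      (integrable_const _).add (hGint'.const_mul _)
    rw [integral_add h2 (hG2.const_mul _), integral_add (integrable_const _) (hGint'.const_mul _),
      integral_const_mul, integral_const_mul]
    simp
    norm_num
  -- The node sums and the terms even in τ cancel whatever the weights are, leaving 2τ∫G.
  have hdiff : err (fun x => ((1 / 2 + τ * G x : ℝ) : ℂ)) -
      err (fun x => ((1 / 2 + (-τ) * G x : ℝ) : ℂ)) ≥ τ * A.card := by
    rw [herrσ, herrσ]
    nlinarith
  have hval : √(A.card : ℝ) / (4 * √(2 ^ d) * ((2 : ℝ) ^ n) ^ r) = τ * A.card / 2 := by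
    have h1 : √K = √(2 ^ d) * ((2 : ℝ) ^ n) ^ r := by
      rw [hK, Real.sqrt_mul (by positivity)]
      congr 1
      rw [mul_comm 2 r, Real.rpow_mul (by positivity), Real.rpow_two,
        Real.sqrt_sq (by positivity)]
    have h2 : √(A.card : ℝ) * √(A.card : ℝ) = A.card := Real.mul_self_sqrt hcard.le
    rw [hτ, Real.sqrt_mul hKpos.le, h1]
    have h3 : 0 < √(A.card : ℝ) := Real.sqrt_pos.2 hcard
    have h4 : 0 < √((2 : ℝ) ^ d) := Real.sqrt_pos.2 (by positivity)
    have h5 : 0 < ((2 : ℝ) ^ n) ^ r := by positivity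
    field_simp
    nlinarith
  have hlarge : ∃ f ∈ realMixedClass d hr, τ * A.card / 2 ≤ |err f| := by
    by_contra! hcon
    have h1 := abs_lt.1 (hcon _ (hmem τ rfl))
    have h2 := abs_lt.1 (hcon _ (hmem (-τ) (by ring)))
    linarith [h1.2, h2.1]
  obtain ⟨f, hf, hferr⟩ := hlarge
  rw [hval]
  exact le_iSup₂_of_le f hf (ENNReal.ofReal_le_ofReal hferr)

/-- The lower bound for the optimal error. -/
theorem exists_le_optimalError (e : ℕ) {r : ℝ} (hr : 1 / 2 < r) :
    ∃ c : ℝ, 0 < c ∧ ∀ m : ℕ, 2 ≤ m →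
      ENNReal.ofReal (c * ((m : ℝ) ^ (-r) * Real.log m ^ ((e : ℝ) / 2))) ≤
        optimalError (torusMeasure (e + 1)) (realMixedClass (e + 1) hr) 2 m := by
  refine ⟨((e : ℝ) + 1) ^ (-((e : ℝ) / 2)) / (4 * √(2 ^ (e + 1)) * 4 ^ r), by positivity,
    fun m hm => ?_⟩
  have hm2 : (2 : ℝ) ≤ m := by exact_mod_cast hm
  have hm0 : (0 : ℝ) < m := by linarith
  -- With n = n' + 1 this gives 2m < 2^n ≤ 4m: enough dimension to fool the nodes, yet 2^n stays
  -- comparable to m.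
  obtain ⟨n', hn1, hn2⟩ := exists_nat_pow_near (show (1 : ℝ) ≤ 2 * m by linarith)
    (one_lt_two (α := ℝ))
  set n := n' + 1 with hn
  have hmn : 2 * m ≤ 2 ^ n := by exact_mod_cast hn2.le
  have hn4 : (2 : ℝ) ^ n ≤ 4 * m := by
    rw [hn, pow_succ]
    linarith
  set A := Finset.piAntidiag (Finset.univ : Finset (Fin (e + 1))) n with hA
  have hAcard := le_card_piAntidiag e n
  rw [← hA] at hAcard
  have hAne : A.Nonempty := Finset.card_pos.1 (lt_of_lt_of_le (by positivity) hAcard)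
  refine le_trans (ENNReal.ofReal_le_ofReal ?_) (le_optimalError hr hmn hAne)
  have hlog0 : 0 ≤ Real.log m := Real.log_nonneg (by linarith)
  have hlogn : Real.log m ≤ n := by
    have h1 : Real.log m ≤ Real.log (2 ^ n) := Real.log_le_log hm0 (by linarith)
    rw [Real.log_pow] at h1
    have h2 := Real.log_two_lt_d9
    have h3 : (0 : ℝ) ≤ n := Nat.cast_nonneg _
    nlinarith
  have hAlog : (Real.log m / (e + 1)) ^ e ≤ (A.card : ℝ) := by
    have h1 : ((n / (e + 1) + 1 : ℕ) : ℝ) ^ e ≤ A.card := by exact_mod_cast hAcard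
    refine le_trans (pow_le_pow_left₀ (by positivity) ?_ e) h1
    rw [div_le_iff₀ (by positivity)]
    refine hlogn.trans ?_
    have h2 : n ≤ (n / (e + 1) + 1) * (e + 1) := by
      have := Nat.lt_div_mul_add (a := n) (Nat.succ_pos e)
      rw [add_mul, one_mul]
      exact this.le
    exact_mod_cast h2
  have hsqrt : Real.log m ^ ((e : ℝ) / 2) * ((e : ℝ) + 1) ^ (-((e : ℝ) / 2)) ≤ √(A.card : ℝ) := by
    refine le_trans (le_of_eq ?_) (Real.sqrt_le_sqrt hAlog)
    rw [Real.sqrt_eq_rpow, ← Real.rpow_natCast, ← Real.rpow_mul (by positivity),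
      Real.rpow_neg (by positivity), ← div_eq_mul_inv, ← Real.div_rpow hlog0 (by positivity)]
    congr 1
    ring
  have hr0 : 0 < r := by linarith
  have hden : ((2 : ℝ) ^ n) ^ r ≤ 4 ^ r * (m : ℝ) ^ r := by
    rw [← Real.mul_rpow (by norm_num) hm0.le]
    exact Real.rpow_le_rpow (by positivity) hn4 hr0.le
  calc _ = (Real.log m ^ ((e : ℝ) / 2) * ((e : ℝ) + 1) ^ (-((e : ℝ) / 2))) /
        (4 * √(2 ^ (e + 1)) * (4 ^ r * (m : ℝ) ^ r)) := by
        rw [Real.rpow_neg hm0.le r]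
        field_simp
    _ ≤ √(A.card : ℝ) / (4 * √(2 ^ (e + 1)) * ((2 : ℝ) ^ n) ^ r) := by
        gcongr

end LowerBound

end SamplingDiscretization

theorem mainTheorem1 (d : ℕ) (hd : 1 ≤ d) (r : ℝ) (hr : 1 / 2 < r) :
    ∃ c C : ℝ, 0 < c ∧ 0 < C ∧
      ∀ W ∈ ({mixedClass d hr, realMixedClass d hr} : Set (Set (Torus d → ℂ))),
        ∀ m : ℕ, 2 ≤ m →
          ENNReal.ofReal (c * ((m : ℝ) ^ (-r) * Real.log m ^ (((d : ℝ) - 1) / 2))) ≤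
              optimalError (torusMeasure d) W 2 m ∧
            optimalError (torusMeasure d) W 2 m ≤
              ENNReal.ofReal (C * ((m : ℝ) ^ (-r) * Real.log m ^ (((d : ℝ) - 1) / 2))) := by
  obtain ⟨e, rfl⟩ : ∃ e, d = e + 1 := ⟨d - 1, by omega⟩
  obtain ⟨c, hc, hlow⟩ := exists_le_optimalError e hr
  obtain ⟨C, hC, hup⟩ := exists_optimalError_le e hr
  refine ⟨c, C, hc, hC, fun W hW m hm => ?_⟩
  have hexp : (((e + 1 : ℕ) : ℝ) - 1) / 2 = (e : ℝ) / 2 := by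
    push_cast
    ring
  rw [hexp]
  -- The error is monotone in the class, so the lower bound for real functions and the upper bound
  -- for complex ones cover both cases.
  have hsub : realMixedClass (e + 1) hr ⊆ W ∧ W ⊆ mixedClass (e + 1) hr := by
    rcases hW with rfl | rfl
    · exact ⟨fun f hf => hf.1, subset_rfl⟩
    · exact ⟨subset_rfl, fun f hf => hf.1⟩
  have hmono : ∀ {W₁ W₂ : Set (Torus (e + 1) → ℂ)}, W₁ ⊆ W₂ →
      optimalError (torusMeasure (e + 1)) W₁ 2 m ≤ optimalError (torusMeasure (e + 1)) W₂ 2 m :=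
    fun h => iInf₂_mono fun ξ w => biSup_mono h
  exact ⟨(hlow m hm).trans (hmono hsub.1), (hmono hsub.2).trans (hup m hm)⟩
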